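/- A \emph{continual diagram} is a function $\omega\colon\mathbb{R}\to\mathbb{R}_+$ such that $|\omega(z_1)-\omega(z_2)|\le|z_1-z_2|$ for all $z_1,z_2\in\mathbb{R}$ and $\omega(z)=|z|$ for all sufficiently large $|z|$. Its Cauchy transform is the function $\mathbf{G}_\omega$ given for $z\in\mathbb{C}\setminus\mathbb{R}$ by \[ \mathbf{G}_\omega(z)=\frac1z\exp\left(-\int_{-\infty}^{\infty}\frac{1}{z-w}\left(\frac{\omega(w)-|w|}{2}\right)'\,dw\right). \] Its transition measure $\mu_\omega$ is the probability measure on $\mathbb{R}$ obtained from $\mathbf{G}_\omega$ by the Stieltjes inversion formula, i.e. $\mu_\omega$ is the vague limit, as $\varepsilon\to0^+$, of the measures $-\frac1\pi\,\mathrm{Im}\,\mathbf{G}_\omega(x+i\varepsilon)\,dx$. Its cumulative function is $K_\omega(z)=\mu_\omega\big((-\infty,z]\big)$. For a Young diagram $\lambda$, drawn in the French convention in the $(x,y)$-plane, the profile $\omega_\lambda$ is the continual diagram whose graph, in the coordinates $u=x-y$, $v=x+y$, is the upper boundary of $\lambda$ (continued by $v=|u|$). \textbf{Proposition.} Let $\omega_1,\omega_2$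 be continual diagrams and let $z_0\in\mathbb{R}$ be such that \[ \omega_1(z)\ge\omega_2(z)\ \text{ for each } z\le z_0,\qquad \omega_1(z)\le\omega_2(z)\ \text{ for each } z\ge z_0. \] Then the left limit $\lim_{\tau\to0^+}K_{\omega_1}(z_0-\tau)$ exists and \[ \lim_{\tau\to0^+}K_{\omega_1}(z_0-\tau)\le K_{\omega_2}(z_0). \] If moreover $\omega_1=\omega_{\lambda^1}$ and $\omega_2=\omega_{\lambda^2}$ are the profiles of Young diagrams $\lambda^1,\lambda^2$, then $K_{\omega_1}(z_0)\le K_{\omega_2}(z_0)$. -/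

import Mathlib

open Filter Topology MeasureTheory

noncomputable section

namespace ContinualDiagrams

/-- A continual diagram: a `1`-Lipschitz function `ω : ℝ → ℝ₊` such that `ω z = |z|` as soon as
`|z|` is sufficiently large. -/
structure IsContinualDiagram (ω : ℝ → ℝ) : Prop where
  nonneg : ∀ z, 0 ≤ ω z
  lipschitz : ∀ z₁ z₂, |ω z₁ - ω z₂| ≤ |z₁ - z₂|
  eventually_abs : ∃ C : ℝ, ∀ z, C ≤ |z| → ω z = |z|

/-- The Cauchy transform `G_ω` of a diagram, for `z` off the real line, given by
`log (z G_ω(z)) = - ∫ (z - w)⁻¹ ((ω(w) - |w|) / 2)' dw`.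
(The derivative exists for almost every `w`, is bounded and has compact support.) -/
def cauchyTransform (ω : ℝ → ℝ) (z : ℂ) : ℂ :=
  z⁻¹ * Complex.exp
    (-∫ w : ℝ, 1 / (z - (w : ℂ)) * ((deriv (fun t : ℝ => (ω t - |t|) / 2) w : ℝ) : ℂ))

/-- The Stieltjes inversion formula: as `ε → 0⁺`, the measures `-π⁻¹ Im G(x + iε) dx` converge
vaguely (i.e. when tested on continuous functions with compact support) to `μ`. This
determines `μ` uniquely among the probability measures, see below. -/
def IsStieltjesInversion (G : ℂ → ℂ) (μ : Measure ℝ) : Prop :=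
  ∀ f : ℝ → ℝ, Continuous f → HasCompactSupport f →
    Tendsto (fun ε : ℝ => ∫ x : ℝ, f x * (-(1 / Real.pi) * (G ((x : ℂ) + (ε : ℂ) * Complex.I)).im))
      (𝓝[>] 0) (𝓝 (∫ x, f x ∂μ))

theorem IsStieltjesInversion.unique {G : ℂ → ℂ} {μ ν : Measure ℝ} [IsProbabilityMeasure μ]
    [IsProbabilityMeasure ν] (hμ : IsStieltjesInversion G μ) (hν : IsStieltjesInversion G ν) :
    μ = ν :=
  Measure.ext_of_integral_eq_on_compactlySupported fun f =>
    tendsto_nhds_unique (hμ f f.continuous f.hasCompactSupport) (hν f f.continuous f.hasCompactSupport)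

open Classical in
/-- The transition measure `μ_ω`: the probability measure on the real line which is obtained from
the Cauchy transform `G_ω` by the Stieltjes inversion formula. -/
def transitionMeasure (ω : ℝ → ℝ) : Measure ℝ :=
  if h : ∃ μ : Measure ℝ, IsProbabilityMeasure μ ∧ IsStieltjesInversion (cauchyTransform ω) μ
  then h.choose else 0

/-- The cumulative function `K_ω(z) = μ_ω((-∞, z])`. -/
def cumulativeFunction (ω : ℝ → ℝ) (z : ℝ) : ℝ :=
  (transitionMeasure ω).real (Set.Iic z)

/-- The profile `ω_λ` of a Young diagram in the Russian coordinates `u = x - y`, `v = x + y`.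
The cell `(i, j)` (row `i`, column `j`) is the unit square `[j, j + 1] × [i, i + 1]` of the
`(x, y)`-plane. The term of the maximum which belongs to the cell `(i, j)` describes the part of
the boundary of the rectangle `[0, j + 1] × [0, i + 1]` off the coordinate axes; the diagram is
the union of these rectangles. -/
def profile (lam : YoungDiagram) (u : ℝ) : ℝ :=
  lam.cells.fold max |u| (fun c => (c.1 : ℝ) + c.2 + 2 - |u - ((c.2 : ℝ) - c.1)|)

/-- The profile is the upper boundary, in the Russian coordinates, of the union of the (closed)
boxes of the Young diagram and of the two half-axes `v = |u|`. -/
theorem isGreatest_profile (lam : YoungDiagram) (u : ℝ) :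
    IsGreatest {v : ℝ | v = |u| ∨ ∃ x y : ℝ, u = x - y ∧ v = x + y ∧
      ∃ c ∈ lam.cells, (c.2 : ℝ) ≤ x ∧ x ≤ c.2 + 1 ∧ (c.1 : ℝ) ≤ y ∧ y ≤ c.1 + 1}
      (profile lam u) := by
  constructor
  · rcases (Finset.le_fold_max (b := |u|) (s := lam.cells)
      (f := fun c => (c.1 : ℝ) + c.2 + 2 - |u - ((c.2 : ℝ) - c.1)|) (profile lam u)).1 le_rfl
      with h | ⟨c, hc, h⟩
    · left
      exact le_antisymm h ((Finset.le_fold_max _).2 (Or.inl le_rfl))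
    · by_cases hlt : profile lam u = |u|
      · exact Or.inl hlt
      right
      have hge : |u| ≤ profile lam u := (Finset.le_fold_max _).2 (Or.inl le_rfl)
      have hle : (c.1 : ℝ) + c.2 + 2 - |u - ((c.2 : ℝ) - c.1)| ≤ profile lam u :=
        (Finset.le_fold_max _).2 (Or.inr ⟨c, hc, le_rfl⟩)
      have hv : profile lam u = (c.1 : ℝ) + c.2 + 2 - |u - ((c.2 : ℝ) - c.1)| := le_antisymm h hle
      have key : ∀ (n : ℕ) (t : ℝ), 0 ≤ t → t ≤ n + 1 → ∃ k ≤ n, (k : ℝ) ≤ t ∧ t ≤ k + 1 := by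
        intro n t h0 h1
        rcases le_total t n with h2 | h2
        · refine ⟨⌊t⌋₊, ?_, Nat.floor_le h0, (Nat.lt_floor_add_one t).le⟩
          exact_mod_cast (Nat.floor_le h0).trans h2
        · exact ⟨n, le_rfl, h2, h1⟩
      refine ⟨(profile lam u + u) / 2, (profile lam u - u) / 2, by ring, by ring, ?_⟩
      have hu1 := (abs_le.1 hge).1
      have hu2 := (abs_le.1 hge).2
      rcases abs_cases (u - ((c.2 : ℝ) - c.1)) with h' | h'
      · obtain ⟨k, hk, hk1, hk2⟩ := key c.1 ((profile lam u - u) / 2) (by linarith) (by linarith)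
        exact ⟨(k, c.2), lam.up_left_mem hk le_rfl hc, by dsimp only; linarith,
          by dsimp only; linarith, hk1, hk2⟩
      · obtain ⟨k, hk, hk1, hk2⟩ := key c.2 ((profile lam u + u) / 2) (by linarith) (by linarith)
        exact ⟨(c.1, k), lam.up_left_mem le_rfl hk hc, hk1, hk2, by dsimp only; linarith,
          by dsimp only; linarith⟩
  · rintro v (rfl | ⟨x, y, hu, hv, c, hc, h1, h2, h3, h4⟩)
    · exact (Finset.le_fold_max _).2 (Or.inl le_rfl)
    · refine (Finset.le_fold_max _).2 (Or.inr ⟨c, hc, ?_⟩)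
      rcases abs_cases (u - ((c.2 : ℝ) - c.1)) with h | h <;> linarith

theorem isContinualDiagram_profile (lam : YoungDiagram) :
    IsContinualDiagram (profile lam) := by
  have habs : ∀ u, |u| ≤ profile lam u := fun u => (Finset.le_fold_max _).2 (Or.inl le_rfl)
  have key : ∀ z₁ z₂, profile lam z₁ ≤ profile lam z₂ + |z₁ - z₂| := by
    intro z₁ z₂
    refine (Finset.fold_max_le _).2 ⟨?_, fun c hc => ?_⟩
    · have := abs_sub_abs_le_abs_sub z₁ z₂
      linarith [habs z₂]
    · have h : (c.1 : ℝ) + c.2 + 2 - |z₂ - ((c.2 : ℝ) - c.1)| ≤ profile lam z₂ :=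
        (Finset.le_fold_max _).2 (Or.inr ⟨c, hc, le_rfl⟩)
      have := abs_sub_le z₂ z₁ ((c.2 : ℝ) - c.1)
      rw [abs_sub_comm z₂ z₁] at this
      linarith
  refine ⟨fun z => (abs_nonneg z).trans (habs z), fun z₁ z₂ => ?_, ?_⟩
  · rw [abs_le]
    have h1 := key z₁ z₂
    have h2 := key z₂ z₁
    rw [abs_sub_comm z₂ z₁] at h2
    constructor <;> linarith
  · refine ⟨∑ c ∈ lam.cells, ((c.1 : ℝ) + c.2 + 1), fun z hz => le_antisymm ?_ (habs z)⟩
    refine (Finset.fold_max_le _).2 ⟨le_rfl, fun c hc => ?_⟩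
    have h1 : (c.1 : ℝ) + c.2 + 1 ≤ |z| :=
      (Finset.single_le_sum (f := fun c : ℕ × ℕ => (c.1 : ℝ) + c.2 + 1)
        (fun _ _ => by positivity) hc).trans hz
    have h2 : (0 : ℝ) ≤ c.1 := by positivity
    have h3 : (0 : ℝ) ≤ c.2 := by positivity
    rcases abs_cases z with h | h <;>
      rcases abs_cases (z - ((c.2 : ℝ) - c.1)) with h' | h' <;> linarith

end ContinualDiagrams

end

namespace ContinualDiagrams

/-! Everything rests on comparing two diagrams `ω₁ ≤ ω₂` which coincide on an open set `U`. Put `d =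
(ω₂ - ω₁) / 2 ≥ 0`. Integration by parts in the exponent of the Cauchy transform gives `G₂(z) =
G₁(z) exp (∫ d(w) / (z - w)² dw)` (`cauchyTransform_eq_mul_exp`). Near a point `x ∈ U` the exponent
extends continuously to the real line, with value `∫ d(w) / (x - w)² dw ≥ 0`. So on `U` the
transition measure `μ₂` has a density `≥ 1` with respect to `μ₁`, and `μ₁ ≤ μ₂` there
(`transitionMeasure_le`).

For diagrams crossing at `z₀`, let `ω` be `ω₁` on the left of `z₀` and `ω₂` on the right. It
dominates both. Since `ω = ω₂` on `(z₀, ∞)`, the upper tail of `ω` is at least that of `ω₂`, that is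
`K_ω(z₀) ≤ K_{ω₂}(z₀)`. Since `ω = ω₁` on `(-∞, z₀)`, `K_{ω₁}(x) ≤ K_ω(x)` for `x < z₀`.
Monotonicity of the cumulative functions joins the two inequalities and provides the left limit.

The argument on the left loses only a possible atom of `μ₁` at `z₀`. A profile has slope `1` or `-1`
immediately to the right of `z₀`: slope `1` forces `ω₁ = ω₂` slightly beyond `z₀`, while slope `-1`
excludes the atom.

All this needs `G_ω` to be the Cauchy transform of a probability measure
(`IsContinualDiagram.isCauchyTransformOn_transitionMeasure`). It is a pointwise limit of rational
functions with interlacing zeros and poles, whose partial fractions have positive coefficients of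
sum `1`. -/

/-! ### Rational functions with interlacing zeros and poles. -/

theorem prod_sub_div_prod_sub_pos {N : ℕ} {x : Fin (N + 1) → ℝ} {y : Fin N → ℝ}
    (hxy : ∀ j, x j.castSucc < y j) (hyx : ∀ j, y j < x j.succ) (i : Fin (N + 1)) :
    0 < ∏ j, (x i - y j) / (x i - x (i.succAbove j)) := by
  have hx : StrictMono x := Fin.strictMono_iff_lt_succ.2 fun j => (hxy j).trans (hyx j)
  refine Finset.prod_pos fun j _ => ?_
  rcases lt_or_ge j.castSucc i with h | h
  · rw [Fin.succAbove_of_castSucc_lt _ _ h]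
    have h1 : x j.succ ≤ x i := hx.monotone (Fin.castSucc_lt_iff_succ_le.1 h)
    have := hxy j
    have := hyx j
    exact div_pos (by linarith) (by linarith)
  · rw [Fin.succAbove_of_le_castSucc _ _ h]
    have h1 : x i ≤ x j.castSucc := hx.monotone h
    have := hxy j
    have := hyx j
    exact div_pos_of_neg_of_neg (by linarith) (by linarith)

/-- Partial fraction decomposition of a rational function with interlacing zeros and poles. -/
theorem exists_partial_fractions {N : ℕ} {x : Fin (N + 1) → ℝ} {y : Fin N → ℝ}
    (hxy : ∀ j, x j.castSucc < y j) (hyx : ∀ j, y j < x j.succ) :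
    ∃ c : Fin (N + 1) → ℝ, (∀ i, 0 ≤ c i) ∧ ∑ i, c i = 1 ∧
      ∀ z : ℂ, (∀ i, z ≠ x i) →
        (∏ j, (z - y j)) / ∏ i, (z - x i) = ∑ i, c i * (1 / (z - x i)) := by
  have hx : StrictMono x := Fin.strictMono_iff_lt_succ.2 fun j => (hxy j).trans (hyx j)
  have hinj : Set.InjOn (fun i => (x i : ℂ)) (Finset.univ : Finset (Fin (N + 1))) :=
    fun i _ j _ h => hx.injective (Complex.ofReal_injective h)
  set P : Polynomial ℂ := Lagrange.nodal Finset.univ fun j => (y j : ℂ) with hP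
  have hdeg : P.degree = N := by simp [hP, Lagrange.degree_nodal]
  have hdeg' : P.degree + 1 = (Finset.univ : Finset (Fin (N + 1))).card := by
    rw [hdeg]; simp
  have hlt : P.degree < (Finset.univ : Finset (Fin (N + 1))).card := by
    rw [hdeg]; simp only [Finset.card_univ, Fintype.card_fin]; exact_mod_cast Nat.lt_succ_self N
  have hc : ∀ i, ((∏ j, (x i - y j) / (x i - x (i.succAbove j)) : ℝ) : ℂ) =
      P.eval (x i : ℂ) * Lagrange.nodalWeight Finset.univ (fun i => (x i : ℂ)) i := by
    intro i
    have : Finset.univ.erase i = Finset.univ.map (Fin.succAboveEmb i) := by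
      ext j
      simp [Fin.exists_succAbove_eq_iff]
    rw [hP, Lagrange.eval_nodal, Lagrange.nodalWeight, this, Finset.prod_map,
      ← Finset.prod_mul_distrib]
    push_cast
    rfl
  refine ⟨fun i => ∏ j, (x i - y j) / (x i - x (i.succAbove j)),
    fun i => (prod_sub_div_prod_sub_pos hxy hyx i).le, ?_, fun z hz => ?_⟩
  -- The residues sum to the leading coefficient of the numerator, which is monic of degree one less
  -- than the number of poles.
  · have h := Lagrange.leadingCoeff_eq_sum hinj hdeg'.symm
    rw [(Lagrange.nodal_monic : P.Monic).leadingCoeff] at h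
    apply Complex.ofReal_injective
    rw [Complex.ofReal_one, h, Complex.ofReal_sum]
    refine Finset.sum_congr rfl fun i _ => ?_
    rw [hc, Lagrange.nodalWeight, Finset.prod_inv_distrib, div_eq_mul_inv]
  · have h1 : P.eval z = ∏ j, (z - y j) := Lagrange.eval_nodal
    have h2 : (Lagrange.nodal Finset.univ fun i => (x i : ℂ)).eval z = ∏ i, (z - x i) :=
      Lagrange.eval_nodal
    have h3 := Lagrange.eval_interpolate_not_at_node (s := Finset.univ)
      (v := fun i => (x i : ℂ)) (fun i => P.eval (x i : ℂ)) (fun i _ => hz i)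
    rw [← Lagrange.eq_interpolate hinj hlt, h2, h1] at h3
    rw [h3, mul_div_cancel_left₀ _ (Finset.prod_ne_zero_iff.2 fun i _ => sub_ne_zero.2 (hz i))]
    refine Finset.sum_congr rfl fun i _ => ?_
    rw [hc]
    ring

/-! ### Cauchy transforms of probability measures and their limits. -/

/-- `G` is, on the upper half-plane, the Cauchy transform of a probability measure
on `[-C, C]`. -/
def IsCauchyTransformOn (C : ℝ) (G : ℂ → ℂ) (μ : Measure ℝ) : Prop :=
  IsProbabilityMeasure μ ∧ μ (Set.Icc (-C) C)ᶜ = 0 ∧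
    ∀ z : ℂ, 0 < z.im → G z = ∫ x : ℝ, 1 / (z - (x : ℂ)) ∂μ

theorem sub_ofReal_ne_zero {z : ℂ} (hz : z.im ≠ 0) (x : ℝ) : z - x ≠ 0 := by
  intro h
  apply hz
  simpa using congrArg Complex.im h

theorem exists_isCauchyTransformOn_rational {C : ℝ} {N : ℕ} {x : Fin (N + 1) → ℝ} {y : Fin N → ℝ}
    (hxy : ∀ j, x j.castSucc < y j) (hyx : ∀ j, y j < x j.succ)
    (hC : ∀ i, x i ∈ Set.Icc (-C) C) :
    ∃ μ, IsCauchyTransformOn C (fun z => (∏ j, (z - y j)) / ∏ i, (z - x i)) μ := by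
  obtain ⟨c, hc0, hc1, hc⟩ := exists_partial_fractions hxy hyx
  refine ⟨∑ i, ENNReal.ofReal (c i) • Measure.dirac (x i), ⟨?_⟩, ?_, fun z hz => ?_⟩
  · simp [← ENNReal.ofReal_sum_of_nonneg fun i _ => hc0 i, hc1]
  · simp only [Measure.coe_finsetSum, Finset.sum_apply, Measure.smul_apply, smul_eq_mul]
    refine Finset.sum_eq_zero fun i _ => ?_
    rw [Measure.dirac_apply' _ measurableSet_Icc.compl]
    simp [hC i]
  · have hz' : ∀ i, z ≠ x i := fun i => sub_ne_zero.1 (sub_ofReal_ne_zero hz.ne' _)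
    refine (hc z hz').trans ?_
    rw [integral_finsetSum_measure]
    · refine Finset.sum_congr rfl fun i _ => ?_
      rw [integral_smul_measure, integral_dirac, ENNReal.toReal_ofReal (hc0 i)]
      simp
    · intro i _
      exact (integrable_dirac (by simp)).smul_measure ENNReal.ofReal_ne_top

theorem norm_one_div_sub_ofReal_le {z : ℂ} (hz : 0 < z.im) (x : ℝ) :
    ‖1 / (z - (x : ℂ))‖ ≤ 1 / z.im := by
  rw [norm_div, norm_one]
  refine one_div_le_one_div_of_le hz ?_
  have := Complex.abs_im_le_norm (z - x)
  simp only [Complex.sub_im, Complex.ofReal_im, sub_zero] at this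
  exact (le_abs_self _).trans this

theorem continuous_one_div_sub_ofReal {z : ℂ} (hz : z.im ≠ 0) :
    Continuous fun x : ℝ => 1 / (z - (x : ℂ)) :=
  continuous_const.div (by fun_prop) (sub_ofReal_ne_zero hz)

/-- The functions which are the Cauchy transforms of probability measures on `[-C, C]` are closed
under pointwise limits. -/
theorem exists_isCauchyTransformOn_of_tendsto {C : ℝ} {F : ℕ → ℂ → ℂ} {G : ℂ → ℂ}
    (hF : ∀ n, ∃ μ, IsCauchyTransformOn C (F n) μ)
    (hG : ∀ z : ℂ, 0 < z.im → Tendsto (fun n => F n z) atTop (𝓝 (G z))) :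
    ∃ μ, IsCauchyTransformOn C G μ := by
  choose μ hμ using hF
  -- Prokhorov's theorem for measures with no mass off a fixed compact interval; the index `ℕ` is a
  -- dummy, as the compact set and the tolerance `0` do not vary.
  have hK : IsCompact {ν : ProbabilityMeasure ℝ |
      ∀ _ : ℕ, ν (Set.Icc (-C) C)ᶜ ≤ (0 : NNReal)} :=
    isCompact_setOfPred_probabilityMeasure_mass_eq_compl_isCompact_le (u := fun _ => 0)
      (K := fun _ => Set.Icc (-C) C) tendsto_const_nhds (fun _ => isCompact_Icc)
      (Or.inl inferInstance)
  set m : ℕ → ProbabilityMeasure ℝ := fun n => ⟨μ n, (hμ n).1⟩ with hm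
  have hmem : ∀ n, m n ∈ {ν : ProbabilityMeasure ℝ |
      ∀ _ : ℕ, ν (Set.Icc (-C) C)ᶜ ≤ (0 : NNReal)} := by
    intro n _
    have := (hμ n).2.1
    rw [← ENNReal.coe_le_coe, ProbabilityMeasure.ennreal_coeFn_eq_coeFn_toMeasure]
    exact this.le
  obtain ⟨ν, hν, hcl⟩ := hK (f := map m atTop)
    (le_principal_iff.2 (Eventually.of_forall hmem : ∀ᶠ n in atTop, _))
  -- Weak convergence along an ultrafilter finer than `atTop` is enough: the limit of `F n z` is
  -- already known.
  obtain ⟨U, hU, hlim⟩ := mapClusterPt_iff_ultrafilter.1 hcl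
  refine ⟨(ν : Measure ℝ), inferInstance, ?_, fun z hz => ?_⟩
  · have := hν 0
    rw [← ENNReal.coe_le_coe, ProbabilityMeasure.ennreal_coeFn_eq_coeFn_toMeasure] at this
    exact le_antisymm this bot_le
  · have h1 := (ProbabilityMeasure.tendsto_iff_forall_integral_rclike_tendsto ℂ).1 hlim
      (BoundedContinuousFunction.ofNormedAddCommGroup _ (continuous_one_div_sub_ofReal hz.ne')
        _ (norm_one_div_sub_ofReal_le hz))
    have h2 : Tendsto (fun n => F n z) U (𝓝 (∫ x : ℝ, 1 / (z - (x : ℂ)) ∂(ν : Measure ℝ))) := by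
      refine h1.congr fun n => ?_
      exact ((hμ n).2.2 z hz).symm
    exact tendsto_nhds_unique ((hG z hz).mono_left hU) h2

/-! ### Stieltjes inversion and the Poisson kernel. -/

theorem im_one_div_sub_ofReal (x y ε : ℝ) :
    (1 / ((x : ℂ) + (ε : ℂ) * Complex.I - (y : ℂ))).im = -(ε / ((x - y) ^ 2 + ε ^ 2)) := by
  rw [one_div, Complex.inv_im]
  simp [Complex.normSq_apply]
  ring

theorem integral_mul_poisson (f : ℝ → ℝ) (y : ℝ) {ε : ℝ} (hε : 0 < ε) :
    ∫ x, f x * ((1 / Real.pi) * (ε / ((x - y) ^ 2 + ε ^ 2))) =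
      ∫ s, f (y + ε * s) * ((1 / Real.pi) * (1 + s ^ 2)⁻¹) := by
  set F : ℝ → ℝ := fun x => f x * ((1 / Real.pi) * (ε / ((x - y) ^ 2 + ε ^ 2))) with hF
  have h1 : ∫ x, F x = ∫ t, F (y + t) := (integral_add_left_eq_self F y).symm
  have h2 : ∫ s, F (y + ε * s) = |ε⁻¹| • ∫ t, F (y + t) :=
    Measure.integral_comp_mul_left (fun t => F (y + t)) ε
  have h3 : ∫ x, F x = ε * ∫ s, F (y + ε * s) := by
    rw [h1, h2, abs_of_pos (inv_pos.2 hε), smul_eq_mul, mul_inv_cancel_left₀ hε.ne']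
  rw [h3, ← integral_const_mul]
  refine integral_congr_ae (Eventually.of_forall fun s => ?_)
  simp only [hF]
  have : (1 + s ^ 2 : ℝ) ≠ 0 := by positivity
  have : (y + ε * s - y) ^ 2 + ε ^ 2 = ε ^ 2 * (1 + s ^ 2) := by ring
  rw [this]
  field_simp

/-- The Cauchy density has total mass `1`, so after the scaling `x = y + ε s` the Poisson kernel is
an approximate identity. -/
theorem tendsto_integral_mul_cauchyKernel {f : ℝ → ℝ} {B : ℝ} (hf : Continuous f)
    (hB : ∀ x, ‖f x‖ ≤ B) (y : ℝ) :
    Tendsto (fun ε : ℝ => ∫ s, f (y + ε * s) * ((1 / Real.pi) * (1 + s ^ 2)⁻¹)) (𝓝[>] 0)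
      (𝓝 (f y)) := by
  have h : ∫ s : ℝ, f y * ((1 / Real.pi) * (1 + s ^ 2)⁻¹) = f y := by
    rw [integral_const_mul, integral_const_mul, integral_univ_inv_one_add_sq]
    field_simp
  rw [← h]
  refine tendsto_integral_filter_of_dominated_convergence
    (fun s => B * ((1 / Real.pi) * (1 + s ^ 2)⁻¹)) ?_ ?_ ?_ ?_
  · refine Eventually.of_forall fun ε => Continuous.aestronglyMeasurable ?_
    have : ∀ s : ℝ, (1 + s ^ 2 : ℝ) ≠ 0 := fun s => by positivity
    fun_prop (disch := assumption)
  · refine Eventually.of_forall fun ε => Eventually.of_forall fun s => ?_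
    rw [norm_mul, Real.norm_of_nonneg (r := 1 / Real.pi * _) (by positivity)]
    exact mul_le_mul_of_nonneg_right (hB _) (by positivity)
  · exact (integrable_inv_one_add_sq.const_mul _).const_mul _
  · refine Eventually.of_forall fun s => Tendsto.mul_const _ ?_
    have : Tendsto (fun ε : ℝ => f (y + ε * s)) (𝓝 0) (𝓝 (f (y + 0 * s))) :=
      (by fun_prop : Continuous fun ε : ℝ => f (y + ε * s)).tendsto 0
    rw [zero_mul, add_zero] at this
    exact this.mono_left nhdsWithin_le_nhds

theorem integrable_one_div_sub_ofReal (μ : Measure ℝ) [IsFiniteMeasure μ] {z : ℂ}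
    (hz : 0 < z.im) : Integrable (fun y : ℝ => 1 / (z - (y : ℂ))) μ :=
  Integrable.of_bound (continuous_one_div_sub_ofReal hz.ne').aestronglyMeasurable _
    (Eventually.of_forall (norm_one_div_sub_ofReal_le hz))

/-- The Stieltjes inversion formula for the Cauchy transform of a probability measure. -/
theorem IsCauchyTransformOn.isStieltjesInversion {C : ℝ} {G : ℂ → ℂ} {μ : Measure ℝ}
    (h : IsCauchyTransformOn C G μ) : IsStieltjesInversion G μ := by
  obtain ⟨hμ, -, hG⟩ := h
  intro f hf hfc
  obtain ⟨B, hB⟩ := hfc.exists_bound_of_continuous hf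
  have key : ∀ ε : ℝ, 0 < ε →
      ∫ x : ℝ, f x * (-(1 / Real.pi) * (G ((x : ℂ) + (ε : ℂ) * Complex.I)).im) =
        ∫ y, (∫ s, f (y + ε * s) * ((1 / Real.pi) * (1 + s ^ 2)⁻¹)) ∂μ := by
    intro ε hε
    have him : ∀ x : ℝ, 0 < ((x : ℂ) + (ε : ℂ) * Complex.I).im := fun x => by simpa using hε
    have h1 : ∀ x : ℝ, f x * (-(1 / Real.pi) * (G ((x : ℂ) + (ε : ℂ) * Complex.I)).im) =
        ∫ y, f x * ((1 / Real.pi) * (ε / ((x - y) ^ 2 + ε ^ 2))) ∂μ := by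
      intro x
      have h2 : (G ((x : ℂ) + (ε : ℂ) * Complex.I)).im =
          ∫ y, (1 / ((x : ℂ) + (ε : ℂ) * Complex.I - (y : ℂ))).im ∂μ := by
        rw [hG _ (him x)]
        exact (integral_im (integrable_one_div_sub_ofReal μ (him x))).symm
      rw [h2, integral_const_mul, integral_const_mul]
      simp_rw [im_one_div_sub_ofReal]
      rw [integral_neg]
      ring
    simp_rw [h1, ← integral_mul_poisson f _ hε]
    refine integral_integral_swap ?_
    refine Integrable.mono' (((hf.integrable_of_hasCompactSupport hfc).norm.comp_fst μ).mul_const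
      ((1 / Real.pi) * (1 / ε))) ?_ (Eventually.of_forall fun p => ?_)
    · refine Continuous.aestronglyMeasurable ?_
      have : ∀ p : ℝ × ℝ, (p.1 - p.2) ^ 2 + ε ^ 2 ≠ 0 := fun p => by positivity
      simp only [Function.uncurry_def]
      fun_prop (disch := assumption)
    · simp only [Function.uncurry_def]
      rw [norm_mul, Real.norm_of_nonneg (r := 1 / Real.pi * _) (by positivity)]
      refine mul_le_mul_of_nonneg_left (mul_le_mul_of_nonneg_left ?_ (by positivity))
        (norm_nonneg _)
      rw [div_le_div_iff₀ (by positivity) hε]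
      nlinarith [sq_nonneg (p.1 - p.2)]
  refine Tendsto.congr' (f₁ := fun ε : ℝ =>
    ∫ y, (∫ s, f (y + ε * s) * ((1 / Real.pi) * (1 + s ^ 2)⁻¹)) ∂μ) ?_ ?_
  · filter_upwards [self_mem_nhdsWithin] with ε hε
    exact (key ε hε).symm
  refine tendsto_integral_filter_of_dominated_convergence (fun _ => B) ?_ ?_
    (integrable_const _) (Eventually.of_forall fun y => tendsto_integral_mul_cauchyKernel hf hB y)
  · refine Eventually.of_forall fun ε => ?_
    refine StronglyMeasurable.aestronglyMeasurable ?_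
    refine StronglyMeasurable.integral_prod_right (f := fun (y s : ℝ) =>
      f (y + ε * s) * ((1 / Real.pi) * (1 + s ^ 2)⁻¹)) ?_
    refine Continuous.stronglyMeasurable ?_
    have : ∀ p : ℝ × ℝ, (1 + p.2 ^ 2 : ℝ) ≠ 0 := fun p => by positivity
    simp only [Function.uncurry_def]
    fun_prop (disch := assumption)
  · refine Eventually.of_forall fun ε => Eventually.of_forall fun y => ?_
    have hb : ∫ s : ℝ, B * ((1 / Real.pi) * (1 + s ^ 2)⁻¹) = B := by
      rw [integral_const_mul, integral_const_mul, integral_univ_inv_one_add_sq]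
      field_simp
    rw [← hb]
    refine norm_integral_le_of_norm_le
      ((integrable_inv_one_add_sq.const_mul _).const_mul _) (Eventually.of_forall fun s => ?_)
    rw [norm_mul, Real.norm_of_nonneg (r := 1 / Real.pi * _) (by positivity)]
    exact mul_le_mul_of_nonneg_right (hB _) (by positivity)

/-- The Cauchy transform `G` of a probability measure is small compared to `1 / ε` in mean
on the line `Im z = ε`. -/
theorem IsCauchyTransformOn.tendsto_mul_integral_norm {C : ℝ} {G : ℂ → ℂ} {μ : Measure ℝ}
    (h : IsCauchyTransformOn C G μ) {K : Set ℝ} (hK : IsCompact K) :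
    Tendsto (fun ε : ℝ => ∫ x in K, ε * ‖G ((x : ℂ) + (ε : ℂ) * Complex.I)‖) (𝓝[>] 0) (𝓝 0) := by
  obtain ⟨hμ, -, hG⟩ := h
  have : IsFiniteMeasure (volume.restrict K) := ⟨by simpa using hK.measure_lt_top⟩
  -- The kernel `ε / |x + iε - y|` is at most `1` and tends to `0` off the diagonal. The diagonal is
  -- null because Lebesgue measure has no atoms, whatever the atoms of `μ`; dominated convergence
  -- then applies.
  have hdiag : ∀ᵐ p : ℝ × ℝ ∂(volume.restrict K).prod μ, p.1 ≠ p.2 := by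
    have hs : MeasurableSet {p : ℝ × ℝ | p.1 = p.2} :=
      measurableSet_eq_fun measurable_fst measurable_snd
    have : (volume.restrict K).prod μ {p : ℝ × ℝ | p.1 = p.2} = 0 := by
      rw [Measure.prod_apply_symm hs, lintegral_eq_zero_iff (measurable_measure_prodMk_right hs)]
      refine Eventually.of_forall fun y => ?_
      have : (fun x : ℝ => (x, y)) ⁻¹' {p : ℝ × ℝ | p.1 = p.2} = {y} := by
        ext x
        simp
      simp [this]
    rw [ae_iff]
    simpa using this
  have him : ∀ {ε : ℝ}, 0 < ε → ∀ x : ℝ, 0 < ((x : ℂ) + (ε : ℂ) * Complex.I).im :=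
    fun hε x => by simpa using hε
  set k : ℝ → ℝ × ℝ → ℝ := fun ε p => ε * ‖1 / ((p.1 : ℂ) + (ε : ℂ) * Complex.I - (p.2 : ℂ))‖
  have hkc : ∀ ε : ℝ, 0 < ε → Continuous (k ε) := by
    intro ε hε
    have : ∀ p : ℝ × ℝ, (p.1 : ℂ) + (ε : ℂ) * Complex.I - (p.2 : ℂ) ≠ 0 := fun p =>
      sub_ofReal_ne_zero (him hε p.1).ne' _
    simp only [k]
    fun_prop (disch := assumption)
  have hkb : ∀ ε : ℝ, 0 < ε → ∀ p, ‖k ε p‖ ≤ 1 := by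
    intro ε hε p
    rw [Real.norm_of_nonneg (by positivity)]
    have := norm_one_div_sub_ofReal_le (him hε p.1) p.2
    simp only [Complex.add_im, Complex.ofReal_im, Complex.mul_im, Complex.ofReal_re,
      Complex.I_im, mul_one, Complex.I_re, mul_zero, add_zero, zero_add] at this
    calc k ε p ≤ ε * (1 / ε) := mul_le_mul_of_nonneg_left this hε.le
      _ = 1 := by field_simp
  have hlim : Tendsto (fun ε : ℝ => ∫ p, k ε p ∂(volume.restrict K).prod μ) (𝓝[>] 0) (𝓝 0) := by
    have h0 : ∫ _ : ℝ × ℝ, (0 : ℝ) ∂(volume.restrict K).prod μ = 0 := integral_zero _ _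
    refine (tendsto_integral_filter_of_dominated_convergence (f := fun _ => (0 : ℝ))
      (fun _ => 1) ?_ ?_ (integrable_const _) ?_).trans_eq (congrArg 𝓝 h0)
    · filter_upwards [self_mem_nhdsWithin] with ε hε
      exact (hkc ε hε).aestronglyMeasurable
    · filter_upwards [self_mem_nhdsWithin] with ε hε
      exact Eventually.of_forall (hkb ε hε)
    · filter_upwards [hdiag] with p hp
      have hne : (p.1 : ℂ) + ((0 : ℝ) : ℂ) * Complex.I - (p.2 : ℂ) ≠ 0 := by
        simpa [sub_eq_zero] using hp
      have : ContinuousAt (fun ε : ℝ => k ε p) 0 := by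
        simp only [k]
        fun_prop (disch := assumption)
      have h0 := this.tendsto
      simp only [k, zero_mul] at h0
      exact h0.mono_left nhdsWithin_le_nhds
  refine squeeze_zero' ?_ ?_ hlim
  · filter_upwards [self_mem_nhdsWithin] with ε hε
    exact integral_nonneg fun x => mul_nonneg (le_of_lt hε) (norm_nonneg _)
  · filter_upwards [self_mem_nhdsWithin] with ε hε
    have hki : Integrable (k ε) ((volume.restrict K).prod μ) :=
      Integrable.of_bound (hkc ε hε).aestronglyMeasurable 1 (Eventually.of_forall (hkb ε hε))
    rw [integral_prod _ hki]
    refine integral_mono_of_nonneg (Eventually.of_forall fun x =>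
      mul_nonneg (le_of_lt hε) (norm_nonneg _)) hki.integral_prod_left
      (Eventually.of_forall fun x => ?_)
    simp only [k]
    rw [integral_const_mul, hG _ (him hε x)]
    exact mul_le_mul_of_nonneg_left (norm_integral_le_integral_norm _) (le_of_lt hε)

/-! ### Exponential formula: passing from densities in `[0, 1]` to interlacing sequences. -/

/-- The path `z - w` stays off the real axis, so the principal logarithm is a primitive. Each
interval carrying density `1` thus yields a pole at its left end and a zero at its right end. -/
theorem exp_neg_integral_one_div {z : ℂ} (hz : z.im ≠ 0) (a b : ℝ) :
    Complex.exp (-∫ w in a..b, 1 / (z - (w : ℂ))) = (z - b) / (z - a) := by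
  have hd : ∀ w : ℝ, HasDerivAt (fun w : ℝ => -Complex.log (z - (w : ℂ))) (1 / (z - (w : ℂ))) w := by
    intro w
    have h1 : HasDerivAt (fun w : ℝ => z - (w : ℂ)) (-1) w :=
      (Complex.ofRealCLM.hasDerivAt (x := w)).const_sub z
    have h2 : z - (w : ℂ) ∈ Complex.slitPlane := by
      refine Complex.mem_slitPlane_iff.2 (Or.inr ?_)
      simpa using hz
    have h3 := (h1.clog_real h2).neg
    simpa [neg_div, Function.comp_def] using! h3
  rw [intervalIntegral.integral_eq_sub_of_hasDerivAt (fun w _ => hd w)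
    ((continuous_one_div_sub_ofReal hz).intervalIntegrable _ _)]
  have ha := sub_ofReal_ne_zero hz a
  have hb := sub_ofReal_ne_zero hz b
  rw [neg_sub, sub_neg_eq_add, add_comm, ← sub_eq_add_neg, Complex.exp_sub,
    Complex.exp_log ha, Complex.exp_log hb]

theorem norm_one_div_sub_one_div_le {z : ℂ} (hz : 0 < z.im) (a b : ℝ) :
    ‖1 / (z - (a : ℂ)) - 1 / (z - (b : ℂ))‖ ≤ |b - a| / z.im ^ 2 := by
  have ha := sub_ofReal_ne_zero hz.ne' a
  have hb := sub_ofReal_ne_zero hz.ne' b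
  have h : 1 / (z - (a : ℂ)) - 1 / (z - (b : ℂ)) =
      ((a - b : ℝ) : ℂ) * (1 / (z - (a : ℂ)) * (1 / (z - (b : ℂ)))) := by
    push_cast
    field_simp
    ring
  rw [h, norm_mul, norm_mul, Complex.norm_real, Real.norm_eq_abs, abs_sub_comm]
  calc |b - a| * (‖1 / (z - (a : ℂ))‖ * ‖1 / (z - (b : ℂ))‖)
      ≤ |b - a| * (1 / z.im * (1 / z.im)) := by
        gcongr
        · exact norm_one_div_sub_ofReal_le hz a
        · exact norm_one_div_sub_ofReal_le hz b
    _ = |b - a| / z.im ^ 2 := by ring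

theorem intervalIntegrable_of_mem_Icc {ψ : ℝ → ℝ} (hm : Measurable ψ)
    (hψ : ∀ w, ψ w ∈ Set.Icc (0 : ℝ) 1) (a b : ℝ) : IntervalIntegrable ψ volume a b := by
  refine (intervalIntegrable_const (c := (1 : ℝ))).mono_fun hm.aestronglyMeasurable
    (Eventually.of_forall fun w => ?_)
  simpa [abs_of_nonneg (hψ w).1] using (hψ w).2

theorem intervalIntegrable_ofReal {ψ : ℝ → ℝ} {a b : ℝ} (hi : IntervalIntegrable ψ volume a b) :
    IntervalIntegrable (fun w => (ψ w : ℂ)) volume a b :=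
  ⟨hi.1.ofReal, hi.2.ofReal⟩

theorem intervalIntegrable_one_div_mul {ψ : ℝ → ℝ} {a b : ℝ} (hi : IntervalIntegrable ψ volume a b)
    {z : ℂ} (hz : z.im ≠ 0) :
    IntervalIntegrable (fun w : ℝ => 1 / (z - (w : ℂ)) * (ψ w : ℂ)) volume a b :=
  (intervalIntegrable_ofReal hi).continuousOn_mul (continuous_one_div_sub_ofReal hz).continuousOn

theorem norm_integral_one_div_mul_sub_le {ψ : ℝ → ℝ} (hm : Measurable ψ)
    (hψ : ∀ w, ψ w ∈ Set.Icc (0 : ℝ) 1) {z : ℂ} (hz : 0 < z.im) {a b : ℝ} (hab : a ≤ b) :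
    ‖(∫ w in a..b, 1 / (z - (w : ℂ)) * (ψ w : ℂ)) - ((∫ w in a..b, ψ w : ℝ) : ℂ) * (1 / (z - b))‖ ≤
      (b - a) ^ 2 / z.im ^ 2 := by
  have hi := intervalIntegrable_of_mem_Icc hm hψ a b
  rw [← intervalIntegral.integral_ofReal, ← intervalIntegral.integral_mul_const,
    ← intervalIntegral.integral_sub (intervalIntegrable_one_div_mul hi hz.ne')
      ((intervalIntegrable_ofReal hi).mul_const _)]
  have h := intervalIntegral.norm_integral_le_of_norm_le_const (a := a) (b := b)
    (C := (b - a) / z.im ^ 2)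
    (f := fun w : ℝ => 1 / (z - (w : ℂ)) * (ψ w : ℂ) - (ψ w : ℂ) * (1 / (z - b))) ?_
  · rw [abs_of_nonneg (sub_nonneg.2 hab)] at h
    exact h.trans (le_of_eq (by ring))
  · intro w hw
    rw [Set.uIoc_of_le hab] at hw
    have h1 : 1 / (z - (w : ℂ)) * (ψ w : ℂ) - (ψ w : ℂ) * (1 / (z - b)) =
        (ψ w : ℂ) * (1 / (z - (w : ℂ)) - 1 / (z - b)) := by ring
    rw [h1, norm_mul, Complex.norm_real, Real.norm_of_nonneg (hψ w).1]
    have h2 := norm_one_div_sub_one_div_le hz w b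
    rw [abs_of_nonneg (sub_nonneg.2 hw.2)] at h2
    calc ψ w * ‖1 / (z - (w : ℂ)) - 1 / (z - b)‖ ≤ 1 * ((b - w) / z.im ^ 2) :=
          mul_le_mul (hψ w).2 h2 (norm_nonneg _) zero_le_one
      _ ≤ (b - a) / z.im ^ 2 := by
          rw [one_mul]
          have := hw.1
          gcongr

/-- On an interval of length `h`, a density with values in `[0, 1]` may be replaced by the indicator
function of a subinterval of about the same mass. -/
theorem norm_integral_one_div_mul_sub_integral_le {ψ : ℝ → ℝ} (hm : Measurable ψ)
    (hψ : ∀ w, ψ w ∈ Set.Icc (0 : ℝ) 1) {z : ℂ} (hz : 0 < z.im) {a b η m : ℝ}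
    (h0 : 0 ≤ m) (h1 : m ≤ b - a) (hη : |(∫ w in a..b, ψ w) - m| ≤ η) :
    ‖(∫ w in a..b, 1 / (z - (w : ℂ)) * (ψ w : ℂ)) - ∫ w in (b - m)..b, 1 / (z - (w : ℂ))‖ ≤
      2 * (b - a) ^ 2 / z.im ^ 2 + η / z.im := by
  have e1 := norm_integral_one_div_mul_sub_le hm hψ hz (show a ≤ b by linarith)
  have e2 := norm_integral_one_div_mul_sub_le (ψ := fun _ => 1) measurable_const
    (fun _ => ⟨zero_le_one, le_rfl⟩) hz (show b - m ≤ b by linarith)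
  simp only [Complex.ofReal_one, mul_one, intervalIntegral.integral_const, smul_eq_mul,
    sub_sub_cancel] at e2
  set I := ∫ w in a..b, 1 / (z - (w : ℂ)) * (ψ w : ℂ)
  set J := ∫ w in (b - m)..b, 1 / (z - (w : ℂ))
  set p := ∫ w in a..b, ψ w
  have h : I - J = (I - p * (1 / (z - b))) + ((p - m : ℝ) : ℂ) * (1 / (z - b)) -
      (J - m * (1 / (z - b))) := by
    push_cast
    ring
  have e3 : ‖((p - m : ℝ) : ℂ) * (1 / (z - b))‖ ≤ η * (1 / z.im) := by
    rw [norm_mul, Complex.norm_real]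
    exact mul_le_mul hη (norm_one_div_sub_ofReal_le hz b) (norm_nonneg _) ((abs_nonneg _).trans hη)
  have e4 : m ^ 2 / z.im ^ 2 ≤ (b - a) ^ 2 / z.im ^ 2 := by gcongr
  rw [h]
  calc _ ≤ ‖I - p * (1 / (z - b))‖ + ‖((p - m : ℝ) : ℂ) * (1 / (z - b))‖ +
      ‖J - m * (1 / (z - b))‖ := (norm_sub_le _ _).trans (add_le_add_left (norm_add_le _ _) _)
    _ ≤ (b - a) ^ 2 / z.im ^ 2 + η * (1 / z.im) + (b - a) ^ 2 / z.im ^ 2 :=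
        add_le_add (add_le_add e1 e3) (e2.trans e4)
    _ = _ := by ring

/-- Let `ψ` have values in `[0, 1]`. Then the function `(z - C)⁻¹ exp (-∫ ψ(w) / (z - w) dw)`, with
the integral over `[-C, C]`, is the Cauchy transform of a probability measure. -/
theorem exists_isCauchyTransformOn_exp {ψ : ℝ → ℝ} (hm : Measurable ψ)
    (hψ : ∀ w, ψ w ∈ Set.Icc (0 : ℝ) 1) {C : ℝ} (hC : 0 < C) :
    ∃ μ, IsCauchyTransformOn C
      (fun z => 1 / (z - C) * Complex.exp (-∫ w in (-C)..C, 1 / (z - (w : ℂ)) * (ψ w : ℂ))) μ := by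
  set h : ℕ → ℝ := fun N => 2 * C / (N + 1) with hh
  set a : ℕ → ℕ → ℝ := fun N k => -C + k * h N with ha
  -- The mass of `ψ` on a cell is mixed with half the cell length, at weight `1 / (N + 1)`, to get
  -- `0 < m < h` and hence strict interlacing. The density is then concentrated on the right part
  -- `[x N k, a N (k + 1)]` of each cell.
  set m : ℕ → ℕ → ℝ := fun N k => (1 - 1 / ((N : ℝ) + 1)) * (∫ w in (a N k)..(a N (k + 1)), ψ w) +
    1 / ((N : ℝ) + 1) * (h N / 2) with hmdef
  set x : ℕ → ℕ → ℝ := fun N k => a N (k + 1) - m N k with hx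
  have hhpos : ∀ N, 0 < h N := fun N => by positivity
  have hstep : ∀ N k, a N (k + 1) - a N k = h N := by
    intro N k
    simp only [ha]
    push_cast
    ring
  have hale : ∀ N k, a N k ≤ a N (k + 1) := fun N k => by linarith [hstep N k, hhpos N]
  have ha0 : ∀ N, a N 0 = -C := fun N => by simp [ha]
  have haN : ∀ N, a N (N + 1) = C := by
    intro N
    simp only [ha, hh]
    push_cast
    field_simp
    ring
  have hp0 : ∀ N k, 0 ≤ ∫ w in (a N k)..(a N (k + 1)), ψ w := fun N k =>
    intervalIntegral.integral_nonneg (hale N k) fun w _ => (hψ w).1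
  have hp1 : ∀ N k, ∫ w in (a N k)..(a N (k + 1)), ψ w ≤ h N := by
    intro N k
    have := intervalIntegral.integral_mono_on (hale N k)
      (intervalIntegrable_of_mem_Icc hm hψ _ _) (intervalIntegrable_const (c := (1 : ℝ)))
      fun w _ => (hψ w).2
    simpa [hstep] using this
  have hθ0 : ∀ N : ℕ, 0 < 1 / ((N : ℝ) + 1) := fun N => by positivity
  have hθ1 : ∀ N : ℕ, 1 / ((N : ℝ) + 1) ≤ 1 := fun N => by
    rw [div_le_one (by positivity)]
    have : (0 : ℝ) ≤ N := by positivity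
    linarith
  have hm0 : ∀ N k, 0 < m N k := fun N k => add_pos_of_nonneg_of_pos
    (mul_nonneg (sub_nonneg.2 (hθ1 N)) (hp0 N k)) (mul_pos (hθ0 N) (half_pos (hhpos N)))
  have hm1 : ∀ N k, m N k < h N := by
    intro N k
    have h1 := mul_le_mul_of_nonneg_left (hp1 N k) (sub_nonneg.2 (hθ1 N))
    have h2 := mul_pos (hθ0 N) (hhpos N)
    simp only [hmdef]
    linarith
  have hmη : ∀ N k, |(∫ w in (a N k)..(a N (k + 1)), ψ w) - m N k| ≤ 1 / ((N : ℝ) + 1) * h N := by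
    intro N k
    have : (∫ w in (a N k)..(a N (k + 1)), ψ w) - m N k =
        1 / ((N : ℝ) + 1) * ((∫ w in (a N k)..(a N (k + 1)), ψ w) - h N / 2) := by
      simp only [hmdef]
      ring
    rw [this, abs_mul, abs_of_pos (hθ0 N)]
    refine mul_le_mul_of_nonneg_left ?_ (hθ0 N).le
    rw [abs_le]
    constructor <;> linarith [hp0 N k, hp1 N k, hhpos N]
  have hxl : ∀ N k, a N k ≤ x N k := fun N k => by
    simp only [hx]
    linarith [hstep N k, hm1 N k]
  have hxr : ∀ N k, x N k ≤ a N (k + 1) := fun N k => by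
    simp only [hx]
    linarith [hm0 N k]
  have hmono : ∀ N, Monotone (a N) := fun N => monotone_nat_of_le_succ (hale N)
  set E : ℂ → ℂ := fun z => ∫ w in (-C)..C, 1 / (z - (w : ℂ)) * (ψ w : ℂ) with hE
  set En : ℕ → ℂ → ℂ := fun N z =>
    ∑ k ∈ Finset.range (N + 1), ∫ w in (x N k)..(a N (k + 1)), 1 / (z - (w : ℂ)) with hEn
  refine exists_isCauchyTransformOn_of_tendsto
    (F := fun N z => 1 / (z - C) * Complex.exp (-En N z)) ?_ ?_
  · intro N
    -- There are `N + 1` poles but only `N` zeros: the last zero `a N (N + 1) = C` cancels against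
    -- the prefactor `1 / (z - C)`.
    obtain ⟨μ, hμ⟩ := exists_isCauchyTransformOn_rational (C := C) (N := N)
      (x := fun i => x N i) (y := fun j => a N (j + 1))
      (fun j => by
        simp only [hx, Fin.val_castSucc]
        linarith [hm0 N j])
      (fun j => by
        simp only [hx, Fin.val_succ]
        linarith [hm1 N (j + 1), hstep N (j + 1)])
      (fun i => ⟨((ha0 N).symm.le.trans (hmono N (Nat.zero_le _))).trans (hxl N i),
        (hxr N i).trans ((hmono N i.2).trans (haN N).le)⟩)
    refine ⟨μ, hμ.1, hμ.2.1, fun z hz => ?_⟩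
    rw [← hμ.2.2 z hz]
    simp only [hEn]
    rw [← Finset.sum_neg_distrib, Complex.exp_sum]
    simp_rw [exp_neg_integral_one_div hz.ne']
    rw [Finset.prod_div_distrib, Finset.prod_range_succ, haN, Finset.prod_range,
      Finset.prod_range]
    have := sub_ofReal_ne_zero hz.ne' C
    field_simp
  · intro z hz
    refine Tendsto.const_mul _ ((Complex.continuous_exp.tendsto _).comp (Tendsto.neg ?_))
    rw [tendsto_iff_norm_sub_tendsto_zero]
    -- Each of the `N + 1` cells contributes an error of order `(N + 1)⁻²`.
    have hbound : ∀ N, ‖En N z - E z‖ ≤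
        (8 * C ^ 2 / z.im ^ 2 + 2 * C / z.im) * (1 / ((N : ℝ) + 1)) := by
      intro N
      have hsplit : E z = ∑ k ∈ Finset.range (N + 1),
          ∫ w in (a N k)..(a N (k + 1)), 1 / (z - (w : ℂ)) * (ψ w : ℂ) := by
        rw [intervalIntegral.sum_integral_adjacent_intervals fun k _ =>
          intervalIntegrable_one_div_mul (intervalIntegrable_of_mem_Icc hm hψ _ _) hz.ne',
          ha0, haN]
      rw [norm_sub_rev, hsplit, hEn, ← Finset.sum_sub_distrib]
      refine (norm_sum_le _ _).trans ((Finset.sum_le_card_nsmul _ _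
        (2 * h N ^ 2 / z.im ^ 2 + 1 / ((N : ℝ) + 1) * h N / z.im) fun k _ => ?_).trans
        (le_of_eq ?_))
      · have := norm_integral_one_div_mul_sub_integral_le hm hψ hz (hm0 N k).le
          ((hm1 N k).le.trans (hstep N k).symm.le) (hmη N k)
        rwa [hstep] at this
      · simp only [hh, Finset.card_range, nsmul_eq_mul]
        push_cast
        field_simp
        ring
    refine squeeze_zero (fun _ => norm_nonneg _) hbound ?_
    have := (tendsto_one_div_add_atTop_nhds_zero_nat (𝕜 := ℝ)).const_mul
      (8 * C ^ 2 / z.im ^ 2 + 2 * C / z.im)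
    rwa [mul_zero] at this

/-! ### Continual diagrams and the existence of the transition measure. -/

theorem IsContinualDiagram.lipschitzWith {ω : ℝ → ℝ} (h : IsContinualDiagram ω) :
    LipschitzWith 1 ω :=
  LipschitzWith.of_dist_le_mul fun x y => by
    simpa [Real.dist_eq] using h.lipschitz x y

/-- The free lower bound `M` allows one radius to serve for two diagrams, or to exceed a given
point. -/
theorem IsContinualDiagram.exists_bound {ω : ℝ → ℝ} (h : IsContinualDiagram ω) (M : ℝ) :
    ∃ C, M < C ∧ 0 < C ∧ ∀ z, C ≤ |z| → ω z = |z| := by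
  obtain ⟨C, hC⟩ := h.eventually_abs
  refine ⟨max C (max (M + 1) 1), ?_, ?_, fun z hz => hC z ((le_max_left _ _).trans hz)⟩
  · exact lt_max_of_lt_right (lt_max_of_lt_left (lt_add_one M))
  · exact lt_max_of_lt_right (lt_max_of_lt_right one_pos)

theorem IsContinualDiagram.half_one_add_deriv_mem {ω : ℝ → ℝ} (h : IsContinualDiagram ω) (w : ℝ) :
    (1 + deriv ω w) / 2 ∈ Set.Icc (0 : ℝ) 1 := by
  have h1 := norm_deriv_le_of_lipschitz h.lipschitzWith (x₀ := w)
  rw [NNReal.coe_one, Real.norm_eq_abs, abs_le] at h1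
  constructor <;> linarith [h1.1, h1.2]

theorem measurable_half_one_add_deriv (ω : ℝ → ℝ) : Measurable fun w => (1 + deriv ω w) / 2 :=
  (measurable_const.add (measurable_deriv ω)).div_const 2

theorem deriv_half_sub_abs_eq_zero {ω : ℝ → ℝ} {C : ℝ} (hC : ∀ z, C ≤ |z| → ω z = |z|)
    {w : ℝ} (hw : C < |w|) : deriv (fun t : ℝ => (ω t - |t|) / 2) w = 0 := by
  have : (fun t : ℝ => (ω t - |t|) / 2) =ᶠ[𝓝 w] fun _ => 0 := by
    filter_upwards [continuous_abs.continuousAt.eventually (lt_mem_nhds hw)] with t ht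
    rw [hC t (le_of_lt ht)]
    simp
  rw [this.deriv_eq, deriv_const]

theorem IsContinualDiagram.ae_deriv_eq {ω : ℝ → ℝ} (h : IsContinualDiagram ω) :
    ∀ᵐ w : ℝ, deriv (fun t : ℝ => (ω t - |t|) / 2) w =
      (1 + deriv ω w) / 2 - if 0 < w then 1 else 0 := by
  have h0 : ∀ᵐ w : ℝ, w ≠ 0 := by simp [ae_iff]
  filter_upwards [h.lipschitzWith.ae_differentiableAt, h0] with w hw hw0
  rw [deriv_div_const, deriv_fun_sub hw (differentiableAt_abs hw0), deriv_abs]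
  rcases lt_or_gt_of_ne hw0 with h1 | h1
  · simp [h1, h1.not_gt]
    ring
  · simp [h1]
    ring

/-- The derivative in the definition is `(1 + ω') / 2`, with values in `[0, 1]`, minus the Heaviside
function. On `[0, C]` the latter contributes the factor `z / (z - C)`, which turns the prefactor `1
/ z` into `1 / (z - C)`. -/
theorem IsContinualDiagram.cauchyTransform_eq {ω : ℝ → ℝ} (h : IsContinualDiagram ω) {C : ℝ}
    (hC0 : 0 < C) (hC : ∀ z, C ≤ |z| → ω z = |z|) {z : ℂ} (hz : z.im ≠ 0) :
    cauchyTransform ω z = 1 / (z - C) * Complex.exp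
      (-∫ w in (-C)..C, 1 / (z - (w : ℂ)) * (((1 + deriv ω w) / 2 : ℝ) : ℂ)) := by
  have hint : ∀ a b, IntervalIntegrable
      (fun w : ℝ => 1 / (z - (w : ℂ)) * (((1 + deriv ω w) / 2 : ℝ) : ℂ)) volume a b := fun a b =>
    intervalIntegrable_one_div_mul (intervalIntegrable_of_mem_Icc
      (measurable_half_one_add_deriv ω) h.half_one_add_deriv_mem a b) hz
  have h1 : ∫ w : ℝ, 1 / (z - (w : ℂ)) * ((deriv (fun t : ℝ => (ω t - |t|) / 2) w : ℝ) : ℂ) =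
      ∫ w in (-C)..C, 1 / (z - (w : ℂ)) * ((deriv (fun t : ℝ => (ω t - |t|) / 2) w : ℝ) : ℂ) := by
    rw [intervalIntegral.integral_of_le (by linarith), ← integral_Icc_eq_integral_Ioc]
    refine (setIntegral_eq_integral_of_forall_compl_eq_zero fun w hw => ?_).symm
    have : C < |w| := by
      by_contra hcon
      exact hw (abs_le.1 (not_lt.1 hcon))
    rw [deriv_half_sub_abs_eq_zero hC this]
    simp
  have h2 : ∫ w in (-C)..0, 1 / (z - (w : ℂ)) * ((deriv (fun t : ℝ => (ω t - |t|) / 2) w : ℝ) : ℂ) =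
      ∫ w in (-C)..0, 1 / (z - (w : ℂ)) * (((1 + deriv ω w) / 2 : ℝ) : ℂ) := by
    refine intervalIntegral.integral_congr_ae ?_
    filter_upwards [h.ae_deriv_eq] with w hw hmem
    rw [Set.uIoc_of_le (by linarith)] at hmem
    rw [hw, if_neg (not_lt.2 hmem.2), sub_zero]
  have h3 : ∫ w in 0..C, 1 / (z - (w : ℂ)) * ((deriv (fun t : ℝ => (ω t - |t|) / 2) w : ℝ) : ℂ) =
      (∫ w in 0..C, 1 / (z - (w : ℂ)) * (((1 + deriv ω w) / 2 : ℝ) : ℂ)) -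
        ∫ w in 0..C, 1 / (z - (w : ℂ)) := by
    rw [← intervalIntegral.integral_sub (hint _ _)
      ((continuous_one_div_sub_ofReal hz).intervalIntegrable _ _)]
    refine intervalIntegral.integral_congr_ae ?_
    filter_upwards [h.ae_deriv_eq] with w hw hmem
    rw [Set.uIoc_of_le hC0.le] at hmem
    rw [hw, if_pos hmem.1]
    push_cast
    ring
  have hint' : ∀ a b, IntervalIntegrable (fun w : ℝ => 1 / (z - (w : ℂ)) *
      ((deriv (fun t : ℝ => (ω t - |t|) / 2) w : ℝ) : ℂ)) volume a b := by
    intro a b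
    refine intervalIntegrable_one_div_mul ?_ hz
    refine (intervalIntegrable_const (c := (2 : ℝ))).mono_fun
      (measurable_deriv _).aestronglyMeasurable (ae_restrict_of_ae ?_)
    filter_upwards [h.ae_deriv_eq] with w hw
    have := h.half_one_add_deriv_mem w
    rw [hw, Real.norm_eq_abs, Real.norm_eq_abs, abs_two, abs_le]
    split_ifs <;> constructor <;> linarith [this.1, this.2]
  rw [cauchyTransform, h1, ← intervalIntegral.integral_add_adjacent_intervals (hint' _ 0) (hint' 0 _),
    h2, h3, ← add_sub_assoc, intervalIntegral.integral_add_adjacent_intervals (hint _ _) (hint _ _),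
    neg_sub, sub_eq_add_neg, Complex.exp_add]
  have h4 := exp_neg_integral_one_div hz 0 C
  rw [Complex.exp_neg, inv_eq_iff_eq_inv] at h4
  rw [h4]
  have := sub_ofReal_ne_zero hz C
  have : z ≠ 0 := by
    rintro rfl
    exact hz rfl
  simp only [Complex.ofReal_zero, sub_zero]
  field_simp

/-- The transition measure exists: the Cauchy transform of a continual diagram is the Cauchy
transform of its transition measure. -/
theorem IsContinualDiagram.isCauchyTransformOn_transitionMeasure {ω : ℝ → ℝ}
    (h : IsContinualDiagram ω) :
    ∃ C, IsCauchyTransformOn C (cauchyTransform ω) (transitionMeasure ω) := by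
  obtain ⟨C, -, hC0, hC⟩ := h.exists_bound 0
  obtain ⟨μ, hμ⟩ := exists_isCauchyTransformOn_exp (measurable_half_one_add_deriv ω)
    h.half_one_add_deriv_mem hC0
  have hμ' : IsCauchyTransformOn C (cauchyTransform ω) μ :=
    ⟨hμ.1, hμ.2.1, fun z hz => (h.cauchyTransform_eq hC0 hC hz.ne').trans (hμ.2.2 z hz)⟩
  have hex : ∃ μ : Measure ℝ, IsProbabilityMeasure μ ∧
      IsStieltjesInversion (cauchyTransform ω) μ := ⟨μ, hμ.1, hμ'.isStieltjesInversion⟩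
  have heq : transitionMeasure ω = μ := by
    rw [transitionMeasure, dif_pos hex]
    have := hex.choose_spec.1
    have := hμ.1
    exact hex.choose_spec.2.unique hμ'.isStieltjesInversion
  exact ⟨C, heq ▸ hμ'⟩

/-! ### The ratio of the Cauchy transforms of two diagrams. -/

theorem integral_mul_deriv_eq_neg_real {g g' d : ℝ → ℝ} (hg : ∀ x, HasDerivAt g (g' x) x)
    (hg' : Continuous g') {K : NNReal} (hd : LipschitzWith K d) {a b : ℝ} (ha : d a = 0)
    (hb : d b = 0) : ∫ x in a..b, g x * deriv d x = -∫ x in a..b, g' x * d x := by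
  have hgd : deriv g = g' := funext fun x => (hg x).deriv
  have hc : ContDiff ℝ 1 g := contDiff_one_iff_deriv.2
    ⟨fun x => (hg x).differentiableAt, hgd ▸ hg'⟩
  rw [AbsolutelyContinuousOnInterval.integral_mul_deriv_eq_deriv_mul
    hc.contDiffOn.absolutelyContinuousOnInterval hd.lipschitzOnWith.absolutelyContinuousOnInterval,
    ha, hb, hgd]
  simp

/-- Integration by parts for a Lipschitz function which vanishes at the ends of the interval. -/
theorem integral_mul_deriv_eq_neg {g g' : ℝ → ℂ} {d : ℝ → ℝ} (hg : ∀ x, HasDerivAt g (g' x) x)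
    (hg' : Continuous g') {K : NNReal} (hd : LipschitzWith K d) {a b : ℝ} (ha : d a = 0)
    (hb : d b = 0) : ∫ x in a..b, g x * ((deriv d x : ℝ) : ℂ) = -∫ x in a..b, g' x * (d x : ℂ) := by
  have hgc : Continuous g := continuous_iff_continuousAt.2 fun x => (hg x).continuousAt
  have hdi : IntervalIntegrable (deriv d) volume a b :=
    (hd.lipschitzOnWith.absolutelyContinuousOnInterval).intervalIntegrable_deriv
  have hi1 : IntervalIntegrable (fun x => g x * ((deriv d x : ℝ) : ℂ)) volume a b :=
    (intervalIntegrable_ofReal hdi).continuousOn_mul hgc.continuousOn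
  have hi2 : IntervalIntegrable (fun x => g' x * (d x : ℂ)) volume a b :=
    (hg'.mul (Complex.continuous_ofReal.comp hd.continuous)).intervalIntegrable _ _
  apply Complex.ext
  · have h1 := Complex.reCLM.intervalIntegral_comp_comm hi1
    have h2 := Complex.reCLM.intervalIntegral_comp_comm hi2
    simp only [Complex.reCLM_apply, Complex.re_mul_ofReal] at h1 h2
    rw [Complex.neg_re, ← h1, ← h2]
    exact integral_mul_deriv_eq_neg_real
      (fun x => by simpa [Function.comp_def] using! Complex.reCLM.hasFDerivAt.comp_hasDerivAt x (hg x))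
      (Complex.continuous_re.comp hg') hd ha hb
  · have h1 := Complex.imCLM.intervalIntegral_comp_comm hi1
    have h2 := Complex.imCLM.intervalIntegral_comp_comm hi2
    simp only [Complex.imCLM_apply, Complex.im_mul_ofReal] at h1 h2
    rw [Complex.neg_im, ← h1, ← h2]
    exact integral_mul_deriv_eq_neg_real
      (fun x => by simpa [Function.comp_def] using! Complex.imCLM.hasFDerivAt.comp_hasDerivAt x (hg x))
      (Complex.continuous_im.comp hg') hd ha hb

/-- The exponents differ by `-∫ d'(w) / (z - w) dw` with `d = (ω₂ - ω₁) / 2`. Since `d` vanishes at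
`±C`, integration by parts removes the derivative, and the sign of `d` becomes usable. -/
theorem cauchyTransform_eq_mul_exp {ω₁ ω₂ : ℝ → ℝ} (h₁ : IsContinualDiagram ω₁)
    (h₂ : IsContinualDiagram ω₂) {z : ℂ} (hz : z.im ≠ 0) :
    cauchyTransform ω₂ z = cauchyTransform ω₁ z *
      Complex.exp (∫ w : ℝ, (1 / (z - (w : ℂ))) ^ 2 * (((ω₂ w - ω₁ w) / 2 : ℝ) : ℂ)) := by
  obtain ⟨C₁, -, -, hC₁⟩ := h₁.exists_bound 0
  obtain ⟨C, hC₁C, hC0, hC₂⟩ := h₂.exists_bound C₁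
  replace hC₁ : ∀ z, C ≤ |z| → ω₁ z = |z| := fun z hz => hC₁ z (hC₁C.le.trans hz)
  have hdz : ∀ w, C ≤ |w| → (ω₂ w - ω₁ w) / 2 = 0 := fun w hw => by
    rw [hC₁ w hw, hC₂ w hw, sub_self, zero_div]
  have hdl : LipschitzWith 1 fun w => (ω₂ w - ω₁ w) / 2 := by
    refine LipschitzWith.of_dist_le_mul fun x y => ?_
    rw [Real.dist_eq, Real.dist_eq, NNReal.coe_one, one_mul]
    have e1 := abs_le.1 (h₁.lipschitz x y)
    have e2 := abs_le.1 (h₂.lipschitz x y)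
    rw [abs_le]
    constructor <;> linarith [e1.1, e1.2, e2.1, e2.2]
  have hi : ∀ {ω : ℝ → ℝ}, IsContinualDiagram ω → IntervalIntegrable
      (fun w : ℝ => 1 / (z - (w : ℂ)) * (((1 + deriv ω w) / 2 : ℝ) : ℂ)) volume (-C) C := fun h =>
    intervalIntegrable_one_div_mul (intervalIntegrable_of_mem_Icc
      (measurable_half_one_add_deriv _) h.half_one_add_deriv_mem _ _) hz
  have e1 : ∫ w : ℝ, (1 / (z - (w : ℂ))) ^ 2 * (((ω₂ w - ω₁ w) / 2 : ℝ) : ℂ) =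
      ∫ w in (-C)..C, (1 / (z - (w : ℂ))) ^ 2 * (((ω₂ w - ω₁ w) / 2 : ℝ) : ℂ) := by
    rw [intervalIntegral.integral_of_le (by linarith), ← integral_Icc_eq_integral_Ioc]
    refine (setIntegral_eq_integral_of_forall_compl_eq_zero fun w hw => ?_).symm
    have : C < |w| := by
      by_contra hcon
      exact hw (abs_le.1 (not_lt.1 hcon))
    rw [hdz w this.le]
    simp
  have hder : ∀ w : ℝ, HasDerivAt (fun w : ℝ => 1 / (z - (w : ℂ))) ((1 / (z - (w : ℂ))) ^ 2) w := by
    intro w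
    have h1 : HasDerivAt (fun w : ℝ => z - (w : ℂ)) (-1) w :=
      (Complex.ofRealCLM.hasDerivAt (x := w)).const_sub z
    have h2 := h1.fun_inv (sub_ofReal_ne_zero hz w)
    simpa [neg_div] using h2
  have e2 := integral_mul_deriv_eq_neg hder ((continuous_one_div_sub_ofReal hz).pow 2) hdl
    (hdz (-C) (by rw [abs_neg]; exact le_abs_self C)) (hdz C (le_abs_self C))
  have e3 : ∫ w in (-C)..C, 1 / (z - (w : ℂ)) *
      ((deriv (fun w => (ω₂ w - ω₁ w) / 2) w : ℝ) : ℂ) =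
      (∫ w in (-C)..C, 1 / (z - (w : ℂ)) * (((1 + deriv ω₂ w) / 2 : ℝ) : ℂ)) -
        ∫ w in (-C)..C, 1 / (z - (w : ℂ)) * (((1 + deriv ω₁ w) / 2 : ℝ) : ℂ) := by
    rw [← intervalIntegral.integral_sub (hi h₂) (hi h₁)]
    refine intervalIntegral.integral_congr_ae ?_
    filter_upwards [h₁.lipschitzWith.ae_differentiableAt, h₂.lipschitzWith.ae_differentiableAt]
      with w hw1 hw2 _
    rw [deriv_div_const, deriv_fun_sub hw2 hw1]
    push_cast
    ring
  rw [h₁.cauchyTransform_eq hC0 hC₁ hz, h₂.cauchyTransform_eq hC0 hC₂ hz, e1,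
    ← neg_eq_iff_eq_neg.2 e2, e3, mul_assoc, ← Complex.exp_add]
  congr 2
  ring

/-! ### Comparison of transition measures where two diagrams coincide. -/

theorem norm_one_div_sq_sub_le {s ε δ : ℝ} (hδ : 0 < δ) (hs : δ ≤ |s|) (hε : 0 < ε) :
    ‖(1 / ((s : ℂ) + (ε : ℂ) * Complex.I)) ^ 2 - ((1 / |s| ^ 2 : ℝ) : ℂ)‖ ≤ 2 * ε / δ ^ 3 := by
  have hs0 : (s : ℂ) ≠ 0 := by
    have : 0 < |s| := hδ.trans_le hs
    exact_mod_cast abs_pos.1 this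
  have hsε : (s : ℂ) + (ε : ℂ) * Complex.I ≠ 0 := by
    intro h
    have := congrArg Complex.im h
    simp at this
    exact hε.ne' this
  have ha : ‖1 / ((s : ℂ) + (ε : ℂ) * Complex.I)‖ ≤ 1 / δ := by
    rw [norm_div, norm_one]
    refine one_div_le_one_div_of_le hδ (hs.trans ?_)
    have := Complex.abs_re_le_norm ((s : ℂ) + (ε : ℂ) * Complex.I)
    simpa using this
  have hb : ‖1 / (s : ℂ)‖ ≤ 1 / δ := by
    rw [norm_div, norm_one, Complex.norm_real]
    exact one_div_le_one_div_of_le hδ hs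
  have h : (1 / ((s : ℂ) + (ε : ℂ) * Complex.I)) ^ 2 - ((1 / |s| ^ 2 : ℝ) : ℂ) =
      -((ε : ℂ) * Complex.I) * (1 / ((s : ℂ) + (ε : ℂ) * Complex.I) * (1 / (s : ℂ))) *
        (1 / ((s : ℂ) + (ε : ℂ) * Complex.I) + 1 / (s : ℂ)) := by
    rw [sq_abs]
    push_cast
    field_simp
    ring
  rw [h, norm_mul, norm_mul, norm_mul, norm_neg, norm_mul, Complex.norm_I, Complex.norm_real,
    Real.norm_of_nonneg hε.le]
  calc _ ≤ ε * 1 * (1 / δ * (1 / δ)) * (1 / δ + 1 / δ) := by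
        gcongr
        exact (norm_add_le _ _).trans (add_le_add ha hb)
    _ = 2 * ε / δ ^ 3 := by
        field_simp
        ring

/-- Truncating the distance at `δ` makes the kernel `1 / |x - w|²` continuous and bounded
everywhere. It is unchanged at distance at least `δ`. -/
theorem continuous_div_max_sq {δ : ℝ} (hδ : 0 < δ) :
    Continuous fun p : ℝ × ℝ => 1 / max δ |p.1 - p.2| ^ 2 := by
  have : ∀ p : ℝ × ℝ, max δ |p.1 - p.2| ^ 2 ≠ 0 := fun p =>
    (pow_pos (lt_max_of_lt_left hδ) 2).ne'
  fun_prop (disch := assumption)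

theorem norm_div_max_sq_mul_le {δ : ℝ} (hδ : 0 < δ) {t : ℝ} (ht : 0 ≤ t) (x w : ℝ) :
    ‖1 / max δ |x - w| ^ 2 * t‖ ≤ 1 / δ ^ 2 * t := by
  have h : 0 < max δ |x - w| := lt_max_of_lt_left hδ
  rw [Real.norm_of_nonneg (by positivity)]
  gcongr
  exact le_max_left _ _

theorem IsCauchyTransformOn.continuous_line {C : ℝ} {G : ℂ → ℂ} {μ : Measure ℝ}
    (h : IsCauchyTransformOn C G μ) {ε : ℝ} (hε : 0 < ε) :
    Continuous fun x : ℝ => G ((x : ℂ) + (ε : ℂ) * Complex.I) := by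
  obtain ⟨hμ, -, hG⟩ := h
  have him : ∀ x : ℝ, ((x : ℂ) + (ε : ℂ) * Complex.I).im = ε := fun x => by simp
  have him' : ∀ x : ℝ, 0 < ((x : ℂ) + (ε : ℂ) * Complex.I).im := fun x => by rwa [him]
  simp_rw [fun x : ℝ => hG _ (him' x)]
  refine continuous_of_dominated (bound := fun _ => 1 / ε) ?_ ?_ (integrable_const _) ?_
  · exact fun x => (continuous_one_div_sub_ofReal (him' x).ne').aestronglyMeasurable
  · intro x
    have := norm_one_div_sub_ofReal_le (him' x)
    rw [him] at this
    exact Eventually.of_forall this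
  · refine Eventually.of_forall fun y => ?_
    have : ∀ x : ℝ, (x : ℂ) + (ε : ℂ) * Complex.I - y ≠ 0 := fun x =>
      sub_ofReal_ne_zero (him' x).ne' y
    fun_prop (disch := assumption)

/-- At distance `δ` from the support of `d`, the exponent approaches its real boundary value at a
rate `O(ε)` uniform in `x`; mere convergence would not suffice against the possible growth of `G₁`
near the line. -/
theorem norm_integral_one_div_sq_sub_le {d : ℝ → ℝ} (hd : Continuous d) (hdi : Integrable d)
    (hd0 : ∀ w, 0 ≤ d w) {x δ ε : ℝ} (hδ : 0 < δ) (hε : 0 < ε)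
    (hx : ∀ w, d w ≠ 0 → δ ≤ |x - w|) :
    ‖(∫ w : ℝ, (1 / ((x : ℂ) + (ε : ℂ) * Complex.I - (w : ℂ))) ^ 2 * (d w : ℂ)) -
      ((∫ w, 1 / max δ |x - w| ^ 2 * d w : ℝ) : ℂ)‖ ≤ 2 * ε / δ ^ 3 * ∫ w, d w := by
  have him : 0 < ((x : ℂ) + (ε : ℂ) * Complex.I).im := by simpa using hε
  have hi1 : Integrable fun w : ℝ =>
      (1 / ((x : ℂ) + (ε : ℂ) * Complex.I - (w : ℂ))) ^ 2 * (d w : ℂ) := by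
    refine hdi.ofReal.bdd_mul ((continuous_one_div_sub_ofReal him.ne').pow 2).aestronglyMeasurable
      (c := (1 / ((x : ℂ) + (ε : ℂ) * Complex.I).im) ^ 2) (Eventually.of_forall fun w => ?_)
    rw [norm_pow]
    exact pow_le_pow_left₀ (norm_nonneg _) (norm_one_div_sub_ofReal_le him w) 2
  have hi2 : Integrable fun w : ℝ => 1 / max δ |x - w| ^ 2 * d w := by
    refine (hdi.const_mul (1 / δ ^ 2)).mono' (Continuous.aestronglyMeasurable ?_)
      (Eventually.of_forall fun w => norm_div_max_sq_mul_le hδ (hd0 w) x w)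
    exact ((continuous_div_max_sq hδ).comp (by fun_prop : Continuous fun w : ℝ => (x, w))).mul hd
  have e : ((∫ w, 1 / max δ |x - w| ^ 2 * d w : ℝ) : ℂ) =
      ∫ w, ((1 / max δ |x - w| ^ 2 * d w : ℝ) : ℂ) := integral_ofReal.symm
  have hi3 : Integrable fun w : ℝ => ((1 / max δ |x - w| ^ 2 * d w : ℝ) : ℂ) := hi2.ofReal
  rw [e, ← integral_sub hi1 hi3, ← integral_const_mul]
  refine norm_integral_le_of_norm_le (hdi.const_mul _) (Eventually.of_forall fun w => ?_)
  rcases eq_or_ne (d w) 0 with h0 | h0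
  · simp [h0]
  · have h1 : (1 / ((x : ℂ) + (ε : ℂ) * Complex.I - (w : ℂ))) ^ 2 * (d w : ℂ) -
        ((1 / max δ |x - w| ^ 2 * d w : ℝ) : ℂ) =
        ((1 / (((x - w : ℝ) : ℂ) + (ε : ℂ) * Complex.I)) ^ 2 -
          ((1 / |x - w| ^ 2 : ℝ) : ℂ)) * (d w : ℂ) := by
      rw [max_eq_right (hx w h0), Complex.ofReal_mul, sub_mul, Complex.ofReal_sub,
        sub_add_eq_add_sub]
    rw [h1, norm_mul, Complex.norm_real, Real.norm_of_nonneg (hd0 w)]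
    exact mul_le_mul_of_nonneg_right (norm_one_div_sq_sub_le hδ (hx w h0) hε) (hd0 w)

/-- Where `G₂ / G₁` has a real analytic extension to the real line with values `≥ 1`, the measure
with Cauchy transform `G₂` dominates the measure with Cauchy transform `G₁`. -/
theorem integral_le_integral_of_eq_mul_exp {C₁ C₂ : ℝ} {G₁ G₂ : ℂ → ℂ} {μ₁ μ₂ : Measure ℝ}
    (h₁ : IsCauchyTransformOn C₁ G₁ μ₁) (h₂ : IsCauchyTransformOn C₂ G₂ μ₂)
    {d : ℝ → ℝ} (hd : Continuous d) (hdi : Integrable d) (hd0 : ∀ w, 0 ≤ d w)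
    (hG : ∀ z : ℂ, 0 < z.im →
      G₂ z = G₁ z * Complex.exp (∫ w : ℝ, (1 / (z - (w : ℂ))) ^ 2 * (d w : ℂ)))
    {U : Set ℝ} (hU : IsOpen U) (hdU : ∀ w ∈ U, d w = 0)
    {f : ℝ → ℝ} (hf : Continuous f) (hfc : HasCompactSupport f) (hf0 : ∀ x, 0 ≤ f x)
    (hfU : tsupport f ⊆ U) : ∫ x, f x ∂μ₁ ≤ ∫ x, f x ∂μ₂ := by
  have := h₁.1
  obtain ⟨B, hB⟩ := hfc.exists_bound_of_continuous hf
  have hB0 : 0 ≤ B := (norm_nonneg _).trans (hB 0)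
  obtain ⟨δ, hδ, hδU⟩ := IsCompact.exists_thickening_subset_open hfc hU hfU
  have hdist : ∀ x ∈ tsupport f, ∀ w, d w ≠ 0 → δ ≤ |x - w| := by
    intro x hx w hw
    by_contra hcon
    refine hw (hdU w (hδU (Metric.mem_thickening_iff.2 ⟨x, hx, ?_⟩)))
    rw [Real.dist_eq, abs_sub_comm]
    exact not_le.1 hcon
  set D : ℝ := ∫ w, d w with hD
  have hD0 : 0 ≤ D := integral_nonneg hd0
  set φ : ℝ → ℝ := fun x => ∫ w, 1 / max δ |x - w| ^ 2 * d w with hφ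
  have hφ0 : ∀ x, 0 ≤ φ x := fun x => integral_nonneg fun w =>
    mul_nonneg (by positivity) (hd0 w)
  have hφD : ∀ x, φ x ≤ 1 / δ ^ 2 * D := by
    intro x
    rw [hD, ← integral_const_mul]
    exact (le_abs_self _).trans (norm_integral_le_of_norm_le (hdi.const_mul _)
      (Eventually.of_forall fun w => norm_div_max_sq_mul_le hδ (hd0 w) x w))
  have hφc : Continuous φ := by
    refine continuous_of_dominated (bound := fun w => 1 / δ ^ 2 * d w) (fun x => ?_)
      (fun x => Eventually.of_forall fun w => norm_div_max_sq_mul_le hδ (hd0 w) x w)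
      (hdi.const_mul _) (Eventually.of_forall fun w => ?_)
    · exact (((continuous_div_max_sq hδ).comp
        (by fun_prop : Continuous fun w : ℝ => (x, w))).mul hd).aestronglyMeasurable
    · exact ((continuous_div_max_sq hδ).comp
        (by fun_prop : Continuous fun x : ℝ => (x, w))).mul continuous_const
  have hgc : Continuous fun x => f x * Real.exp (φ x) := hf.mul (Real.continuous_exp.comp hφc)
  have hgs : HasCompactSupport fun x => f x * Real.exp (φ x) := hfc.mul_right
  have lim₁ := h₁.isStieltjesInversion _ hgc hgs
  have lim₂ := h₂.isStieltjesInversion _ hf hfc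
  set A : ℝ → ℝ → ℂ := fun ε x =>
    ∫ w : ℝ, (1 / ((x : ℂ) + (ε : ℂ) * Complex.I - (w : ℂ))) ^ 2 * (d w : ℂ) with hA
  set M : ℝ := Real.exp (1 / δ ^ 2 * D) * (2 * (2 / δ ^ 3 * D)) with hM
  have hM0 : 0 ≤ M := by positivity
  have hexp : ∀ᶠ ε : ℝ in 𝓝[>] 0, ∀ x ∈ tsupport f,
      ‖Complex.exp (A ε x) - Complex.exp (φ x)‖ ≤ M * ε := by
    have hsmall : ∀ᶠ ε : ℝ in 𝓝[>] 0, 2 * ε / δ ^ 3 * D < 1 := by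
      have : Tendsto (fun ε : ℝ => 2 * ε / δ ^ 3 * D) (𝓝 0) (𝓝 (2 * 0 / δ ^ 3 * D)) :=
        (by fun_prop : Continuous fun ε : ℝ => 2 * ε / δ ^ 3 * D).tendsto 0
      refine (this.mono_left nhdsWithin_le_nhds).eventually (gt_mem_nhds ?_)
      simp
    filter_upwards [self_mem_nhdsWithin, hsmall] with ε hε hε1 x hx
    have h1 : ‖A ε x - φ x‖ ≤ 2 * ε / δ ^ 3 * D :=
      norm_integral_one_div_sq_sub_le hd hdi hd0 hδ hε (hdist x hx)
    have h2 : Complex.exp (A ε x) - Complex.exp (φ x) =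
        Complex.exp (φ x) * (Complex.exp (A ε x - φ x) - 1) := by
      rw [mul_sub, ← Complex.exp_add, mul_one, add_sub_cancel]
    rw [h2, norm_mul, Complex.norm_exp, Complex.ofReal_re]
    calc Real.exp (φ x) * ‖Complex.exp (A ε x - φ x) - 1‖
        ≤ Real.exp (1 / δ ^ 2 * D) * (2 * (2 * ε / δ ^ 3 * D)) := by
          refine mul_le_mul (Real.exp_le_exp.2 (hφD x)) ?_ (norm_nonneg _) (Real.exp_pos _).le
          exact (Complex.norm_exp_sub_one_le (h1.trans hε1.le)).trans
            (mul_le_mul_of_nonneg_left h1 zero_le_two)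
      _ = M * ε := by
          rw [hM]
          ring
  have him : ∀ {ε : ℝ}, 0 < ε → ∀ x : ℝ, 0 < ((x : ℂ) + (ε : ℂ) * Complex.I).im :=
    fun hε x => by simpa using hε
  have hint : ∀ {C : ℝ} {G : ℂ → ℂ} {μ : Measure ℝ} {g : ℝ → ℝ} {ε : ℝ}, 0 < ε →
      IsCauchyTransformOn C G μ → Continuous g → HasCompactSupport g →
      Integrable fun x => g x * (-(1 / Real.pi) * (G ((x : ℂ) + (ε : ℂ) * Complex.I)).im) :=
    fun hε hGμ hg hgs => (hg.mul (continuous_const.mul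
      (Complex.continuous_im.comp (hGμ.continuous_line hε)))).integrable_of_hasCompactSupport
        hgs.mul_right
  -- Replacing the complex exponential by its real boundary value costs at most a constant times `∫
  -- ε ‖G₁‖` over the support of `f`, which tends to `0`.
  have hdiff : Tendsto (fun ε : ℝ =>
      (∫ x : ℝ, f x * (-(1 / Real.pi) * (G₂ ((x : ℂ) + (ε : ℂ) * Complex.I)).im)) -
        ∫ x : ℝ, f x * Real.exp (φ x) *
          (-(1 / Real.pi) * (G₁ ((x : ℂ) + (ε : ℂ) * Complex.I)).im)) (𝓝[>] 0) (𝓝 0) := by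
    have hb := (h₁.tendsto_mul_integral_norm hfc).const_mul (B * (1 / Real.pi) * M)
    rw [mul_zero] at hb
    refine squeeze_zero_norm' ?_ hb
    filter_upwards [self_mem_nhdsWithin, hexp] with ε hε hε'
    rw [← integral_sub (hint hε h₂ hf hfc) (hint hε h₁ hgc hgs), ← integral_const_mul,
      ← integral_indicator hfc.measurableSet]
    refine norm_integral_le_of_norm_le ?_ (Eventually.of_forall fun x => ?_)
    · refine IntegrableOn.integrable_indicator (ContinuousOn.integrableOn_compact hfc ?_)
        hfc.measurableSet
      exact (continuous_const.mul
        (continuous_const.mul (h₁.continuous_line hε).norm)).continuousOn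
    · by_cases hx : x ∈ tsupport f
      · rw [Set.indicator_of_mem hx]
        set z : ℂ := (x : ℂ) + (ε : ℂ) * Complex.I with hz
        have e : f x * (-(1 / Real.pi) * (G₂ z).im) -
            f x * Real.exp (φ x) * (-(1 / Real.pi) * (G₁ z).im) =
            f x * (-(1 / Real.pi) *
              (G₁ z * (Complex.exp (A ε x) - Complex.exp (φ x))).im) := by
          rw [hG z (him hε x), mul_sub, Complex.sub_im, ← Complex.ofReal_exp,
            Complex.im_mul_ofReal]
          ring
        rw [e, norm_mul, norm_mul, norm_neg, Real.norm_of_nonneg (r := 1 / Real.pi)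
          (by positivity)]
        have h3 : ‖(G₁ z * (Complex.exp (A ε x) - Complex.exp (φ x))).im‖ ≤ ‖G₁ z‖ * (M * ε) :=
          (Complex.abs_im_le_norm _).trans (by
            rw [norm_mul]
            exact mul_le_mul_of_nonneg_left (hε' x hx) (norm_nonneg _))
        calc ‖f x‖ * (1 / Real.pi *
              ‖(G₁ z * (Complex.exp (A ε x) - Complex.exp (φ x))).im‖)
            ≤ B * (1 / Real.pi * (‖G₁ z‖ * (M * ε))) := by
              refine mul_le_mul (hB x) (mul_le_mul_of_nonneg_left h3 (by positivity))
                (by positivity) hB0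
          _ = B * (1 / Real.pi) * M * (ε * ‖G₁ z‖) := by ring
      · rw [Set.indicator_of_notMem hx, image_eq_zero_of_notMem_tsupport hx]
        simp
  -- In effect `μ₂ = exp(φ) μ₁` when tested against `f`, with `φ ≥ 0`.
  have heq : ∫ x, f x ∂μ₂ = ∫ x, f x * Real.exp (φ x) ∂μ₁ :=
    sub_eq_zero.1 (tendsto_nhds_unique (lim₂.sub lim₁) hdiff)
  rw [heq]
  refine integral_mono (hf.integrable_of_hasCompactSupport hfc)
    (hgc.integrable_of_hasCompactSupport hgs) fun x => ?_
  exact le_mul_of_one_le_right (hf0 x) (Real.one_le_exp (hφ0 x))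

/-- If the integrals of compactly supported functions in the open set `U` are ordered, then so are
the measures on `U`. -/
theorem measure_le_of_forall_integral_le {μ₁ μ₂ : Measure ℝ} [IsFiniteMeasure μ₁]
    [IsFiniteMeasure μ₂] {U : Set ℝ} (hU : IsOpen U)
    (h : ∀ f : ℝ → ℝ, Continuous f → HasCompactSupport f → (∀ x, 0 ≤ f x) → tsupport f ⊆ U →
      ∫ x, f x ∂μ₁ ≤ ∫ x, f x ∂μ₂)
    {A : Set ℝ} (hA : MeasurableSet A) (hAU : A ⊆ U) : μ₁ A ≤ μ₂ A := by
  have hcompact : ∀ K : Set ℝ, IsCompact K → K ⊆ U → μ₁ K ≤ μ₂ K := by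
    intro K hK hKU
    -- Outer regularity of `μ₂`: a Urysohn function between `K` and an open `V ⊇ K`, supported in `V
    -- ∩ U`, compares `μ₁ K` with `μ₂ V`.
    rw [K.measure_eq_iInf_isOpen μ₂]
    refine le_iInf₂ fun V hKV => le_iInf fun hV => ?_
    obtain ⟨k, -, hkc, hKk, hkV⟩ := exists_compact_closed_between hK (hV.inter hU)
      (Set.subset_inter hKV hKU)
    obtain ⟨f, hf1, hf0, hfs, hf01⟩ := exists_continuous_one_zero_of_isCompact hK
      isOpen_interior.isClosed_compl (Set.disjoint_compl_right_iff_subset.2 hKk)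
    have hfk : tsupport f ⊆ k := by
      refine closure_minimal (fun x hx => ?_) hkc
      by_contra hcon
      exact hx (hf0 fun hxk => hcon (interior_subset hxk))
    have hfi : ∀ (μ : Measure ℝ) [IsFiniteMeasure μ], Integrable f μ := fun μ _ =>
      f.continuous.integrable_of_hasCompactSupport hfs
    have h1 : μ₁.real K ≤ ∫ x, f x ∂μ₁ := by
      rw [← integral_indicator_one hK.measurableSet]
      refine integral_mono ((integrable_const (1 : ℝ)).indicator hK.measurableSet) (hfi μ₁)
        fun x => ?_
      by_cases hx : x ∈ K
      · simp [hx, hf1 hx]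
      · simpa [hx] using (hf01 x).1
    have h2 : ∫ x, f x ∂μ₂ ≤ μ₂.real V := by
      rw [← integral_indicator_one hV.measurableSet]
      refine integral_mono (hfi μ₂) ((integrable_const (1 : ℝ)).indicator hV.measurableSet)
        fun x => ?_
      by_cases hx : x ∈ V
      · simpa [hx] using (hf01 x).2
      · have : f x = 0 := image_eq_zero_of_notMem_tsupport fun hxf => hx (hkV (hfk hxf)).1
        simp [hx, this]
    have h3 := h f f.continuous hfs (fun x => (hf01 x).1) fun x hx => (hkV (hfk hx)).2
    exact (ENNReal.toReal_le_toReal (measure_ne_top _ _) (measure_ne_top _ _)).1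
      (h1.trans (h3.trans h2))
  rw [hA.measure_eq_iSup_isCompact_of_ne_top (measure_ne_top _ _)]
  refine iSup₂_le fun K hKA => iSup_le fun hK => ?_
  exact (hcompact K hK (hKA.trans hAU)).trans (measure_mono hKA)

theorem transitionMeasure_le {ω₁ ω₂ : ℝ → ℝ} (h₁ : IsContinualDiagram ω₁)
    (h₂ : IsContinualDiagram ω₂) (hle : ∀ z, ω₁ z ≤ ω₂ z) {U : Set ℝ} (hU : IsOpen U)
    (heq : ∀ z ∈ U, ω₁ z = ω₂ z) {A : Set ℝ} (hA : MeasurableSet A) (hAU : A ⊆ U) :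
    transitionMeasure ω₁ A ≤ transitionMeasure ω₂ A := by
  obtain ⟨C₁, hC₁⟩ := h₁.isCauchyTransformOn_transitionMeasure
  obtain ⟨C₂, hC₂⟩ := h₂.isCauchyTransformOn_transitionMeasure
  have := hC₁.1
  have := hC₂.1
  have hc : Continuous fun w => (ω₂ w - ω₁ w) / 2 :=
    (h₂.lipschitzWith.continuous.sub h₁.lipschitzWith.continuous).div_const 2
  have hs : HasCompactSupport fun w => (ω₂ w - ω₁ w) / 2 := by
    obtain ⟨R₁, -, -, hR₁⟩ := h₁.exists_bound 0
    obtain ⟨R, hR, -, hR₂⟩ := h₂.exists_bound R₁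
    refine HasCompactSupport.intro (isCompact_Icc (a := -R) (b := R)) fun w hw => ?_
    have hw' : R ≤ |w| := by
      by_contra hcon
      exact hw (abs_le.1 (not_le.1 hcon).le)
    rw [hR₂ w hw', hR₁ w (hR.le.trans hw'), sub_self, zero_div]
  refine measure_le_of_forall_integral_le hU (fun f hf hfc hf0 hfU => ?_) hA hAU
  exact integral_le_integral_of_eq_mul_exp hC₁ hC₂ hc (hc.integrable_of_hasCompactSupport hs)
    (fun w => div_nonneg (sub_nonneg.2 (hle w)) zero_le_two)
    (fun z hz => cauchyTransform_eq_mul_exp h₁ h₂ hz.ne') hU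
    (fun w hw => by rw [heq w hw, sub_self, zero_div]) hf hfc hf0 hfU

/-! ### Cumulative functions and the interpolating diagram. -/

theorem IsContinualDiagram.isProbabilityMeasure_transitionMeasure {ω : ℝ → ℝ}
    (h : IsContinualDiagram ω) : IsProbabilityMeasure (transitionMeasure ω) :=
  h.isCauchyTransformOn_transitionMeasure.choose_spec.1

theorem IsContinualDiagram.piecewise {ω₁ ω₂ : ℝ → ℝ} {z₀ : ℝ} (h₁ : IsContinualDiagram ω₁)
    (h₂ : IsContinualDiagram ω₂) (h : ω₁ z₀ = ω₂ z₀) :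
    IsContinualDiagram fun z => if z ≤ z₀ then ω₁ z else ω₂ z := by
  have key : ∀ z₁ z₂, z₁ ≤ z₀ → z₀ ≤ z₂ → |ω₁ z₁ - ω₂ z₂| ≤ |z₁ - z₂| := by
    intro z₁ z₂ hz₁ hz₂
    have e1 := h₁.lipschitz z₁ z₀
    have e2 := h₂.lipschitz z₀ z₂
    rw [abs_of_nonpos (by linarith : z₁ - z₀ ≤ 0), abs_le] at e1
    rw [abs_of_nonpos (by linarith : z₀ - z₂ ≤ 0), abs_le] at e2
    rw [abs_of_nonpos (by linarith : z₁ - z₂ ≤ 0), abs_le]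
    constructor <;> linarith [e1.1, e1.2, e2.1, e2.2]
  refine ⟨fun z => ?_, fun z₁ z₂ => ?_, ?_⟩
  · split_ifs
    exacts [h₁.nonneg z, h₂.nonneg z]
  · rcases le_or_gt z₁ z₀ with hz₁ | hz₁ <;> rcases le_or_gt z₂ z₀ with hz₂ | hz₂
    · simpa [hz₁, hz₂] using h₁.lipschitz z₁ z₂
    · simpa [hz₁, hz₂.not_ge] using key z₁ z₂ hz₁ hz₂.le
    · have := key z₂ z₁ hz₂ hz₁.le
      rw [abs_sub_comm, abs_sub_comm z₂] at this
      simpa [hz₁.not_ge, hz₂] using this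
    · simpa [hz₁.not_ge, hz₂.not_ge] using h₂.lipschitz z₁ z₂
  · obtain ⟨C₁, hC₁⟩ := h₁.eventually_abs
    obtain ⟨C₂, hC₂⟩ := h₂.eventually_abs
    refine ⟨max C₁ C₂, fun z hz => ?_⟩
    split_ifs
    exacts [hC₁ z ((le_max_left _ _).trans hz), hC₂ z ((le_max_right _ _).trans hz)]

theorem IsContinualDiagram.monotone_cumulativeFunction {ω : ℝ → ℝ} (h : IsContinualDiagram ω) :
    Monotone (cumulativeFunction ω) := by
  have := h.isProbabilityMeasure_transitionMeasure
  exact fun x y hxy => measureReal_mono (Set.Iic_subset_Iic.2 hxy)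

theorem cumulativeFunction_le_of_eqOn {ω₁ ω₂ : ℝ → ℝ} (h₁ : IsContinualDiagram ω₁)
    (h₂ : IsContinualDiagram ω₂) (hle : ∀ z, ω₁ z ≤ ω₂ z) {a x : ℝ} (hx : x < a)
    (heq : ∀ z < a, ω₁ z = ω₂ z) : cumulativeFunction ω₁ x ≤ cumulativeFunction ω₂ x := by
  have := h₁.isProbabilityMeasure_transitionMeasure
  have := h₂.isProbabilityMeasure_transitionMeasure
  exact (ENNReal.toReal_le_toReal (measure_ne_top _ _) (measure_ne_top _ _)).2
    (transitionMeasure_le h₁ h₂ hle isOpen_Iio heq measurableSet_Iic (Set.Iic_subset_Iio.2 hx))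

/-- The comparison holds for the upper tails; passing to complements in probability measures
reverses it. -/
theorem cumulativeFunction_le_of_eqOn_gt {ω₁ ω₂ : ℝ → ℝ} (h₁ : IsContinualDiagram ω₁)
    (h₂ : IsContinualDiagram ω₂) (hle : ∀ z, ω₁ z ≤ ω₂ z) {a : ℝ}
    (heq : ∀ z, a < z → ω₁ z = ω₂ z) : cumulativeFunction ω₂ a ≤ cumulativeFunction ω₁ a := by
  have := h₁.isProbabilityMeasure_transitionMeasure
  have := h₂.isProbabilityMeasure_transitionMeasure
  have h : (transitionMeasure ω₁).real (Set.Ioi a) ≤ (transitionMeasure ω₂).real (Set.Ioi a) :=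
    (ENNReal.toReal_le_toReal (measure_ne_top _ _) (measure_ne_top _ _)).2
      (transitionMeasure_le h₁ h₂ hle isOpen_Ioi heq measurableSet_Ioi le_rfl)
  rw [← Set.compl_Iic, probReal_compl_eq_one_sub measurableSet_Iic,
    probReal_compl_eq_one_sub measurableSet_Iic] at h
  rw [cumulativeFunction, cumulativeFunction]
  linarith

/-- The diagram which agrees with `ω₁` up to `z₀` and with `ω₂` from `z₀` on interpolates between
two diagrams which cross at `z₀`. -/
theorem cumulativeFunction_piecewise_le {ω₁ ω₂ : ℝ → ℝ} {z₀ : ℝ} (h₁ : IsContinualDiagram ω₁)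
    (h₂ : IsContinualDiagram ω₂) (hl : ∀ z, z ≤ z₀ → ω₂ z ≤ ω₁ z)
    (hr : ∀ z, z₀ ≤ z → ω₁ z ≤ ω₂ z) :
    cumulativeFunction (fun z => if z ≤ z₀ then ω₁ z else ω₂ z) z₀ ≤ cumulativeFunction ω₂ z₀ := by
  refine cumulativeFunction_le_of_eqOn_gt h₂
    (h₁.piecewise h₂ (le_antisymm (hr z₀ le_rfl) (hl z₀ le_rfl))) (fun z => ?_) fun z hz => ?_
  · split_ifs with h
    exacts [hl z h, le_rfl]
  · rw [if_neg hz.not_ge]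

/-- The parameter `a` is `z₀` for general diagrams. A value beyond `z₀`, possible if the diagrams
agree a little further, lets `x = z₀` be taken. -/
theorem cumulativeFunction_le_piecewise {ω₁ ω₂ : ℝ → ℝ} {z₀ a x : ℝ} (h₁ : IsContinualDiagram ω₁)
    (h₂ : IsContinualDiagram ω₂) (h : ω₁ z₀ = ω₂ z₀) (hr : ∀ z, z₀ ≤ z → ω₁ z ≤ ω₂ z)
    (ha : ∀ z, z₀ < z → z < a → ω₁ z = ω₂ z) (hx : x < a) :
    cumulativeFunction ω₁ x ≤ cumulativeFunction (fun z => if z ≤ z₀ then ω₁ z else ω₂ z) x := by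
  refine cumulativeFunction_le_of_eqOn h₁ (h₁.piecewise h₂ h) (fun z => ?_) hx fun z hz => ?_
  · split_ifs with h'
    exacts [le_rfl, hr z (not_le.1 h').le]
  · split_ifs with h'
    exacts [rfl, ha z (not_le.1 h') hz]

theorem cumulativeFunction_le_of_lt {ω₁ ω₂ : ℝ → ℝ} {z₀ x : ℝ} (h₁ : IsContinualDiagram ω₁)
    (h₂ : IsContinualDiagram ω₂) (hl : ∀ z, z ≤ z₀ → ω₂ z ≤ ω₁ z)
    (hr : ∀ z, z₀ ≤ z → ω₁ z ≤ ω₂ z) (hx : x < z₀) :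
    cumulativeFunction ω₁ x ≤ cumulativeFunction ω₂ z₀ := by
  have h : ω₁ z₀ = ω₂ z₀ := le_antisymm (hr z₀ le_rfl) (hl z₀ le_rfl)
  refine (cumulativeFunction_le_piecewise h₁ h₂ h hr
    (fun z hz hz' => absurd hz hz'.not_gt) hx).trans ?_
  exact ((h₁.piecewise h₂ h).monotone_cumulativeFunction hx.le).trans
    (cumulativeFunction_piecewise_le h₁ h₂ hl hr)

/-! ### Profiles of Young diagrams: local slopes and atoms. -/

/-- The transition measure has no atom at a point to the right of which the diagram decreases with
slope `-1`. -/
theorem IsContinualDiagram.transitionMeasure_singleton_eq_zero {ω : ℝ → ℝ}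
    (h : IsContinualDiagram ω) {z₀ δ : ℝ} (hδ : 0 < δ)
    (hω : ∀ z, z₀ ≤ z → z < z₀ + δ → ω z = ω z₀ - (z - z₀)) :
    transitionMeasure ω {z₀} = 0 := by
  have hμ := h.isProbabilityMeasure_transitionMeasure
  obtain ⟨C', -, -, hG⟩ := h.isCauchyTransformOn_transitionMeasure
  obtain ⟨C, hzC, hC0, hC⟩ := h.exists_bound |z₀|
  set ψ : ℝ → ℝ := fun w => (1 + deriv ω w) / 2 with hψ
  have hψ0 : ∀ w, z₀ < w → w < z₀ + δ → ψ w = 0 := by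
    intro w h1 h2
    have : ω =ᶠ[𝓝 w] fun z => ω z₀ - (z - z₀) := by
      filter_upwards [Ioo_mem_nhds h1 h2] with z hz
      exact hω z hz.1.le hz.2
    have hd : deriv (fun z => ω z₀ - (z - z₀)) w = -1 := by
      have := ((hasDerivAt_id w).sub_const z₀).const_sub (ω z₀)
      exact this.deriv
    simp only [hψ]
    rw [this.deriv_eq, hd]
    norm_num
  have him : ∀ {t : ℝ}, 0 < t → 0 < ((z₀ : ℂ) + (t : ℂ) * Complex.I).im := fun ht => by
    simpa using ht
  have hzC' : 0 < C - z₀ := by linarith [le_abs_self z₀]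
  set B : ℝ := 1 / (C - z₀) * Real.exp (1 / δ * (2 * C)) with hB
  -- The real part of the exponent is `∫ (w - z₀) ψ(w) / ((w - z₀)² + t²) dw`. The part `w < z₀` is
  -- nonpositive, `ψ` vanishes on `(z₀, z₀ + δ)`, and beyond that the integrand is at most `1 / δ`,
  -- on an interval of total length `2 * C`.
  have hbound : ∀ t : ℝ, 0 < t → ‖cauchyTransform ω ((z₀ : ℂ) + (t : ℂ) * Complex.I)‖ ≤ B := by
    intro t ht
    rw [h.cauchyTransform_eq hC0 hC (him ht).ne', norm_mul, Complex.norm_exp]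
    refine mul_le_mul ?_ (Real.exp_le_exp.2 ?_) (Real.exp_pos _).le (by positivity)
    · rw [norm_div, norm_one]
      refine one_div_le_one_div_of_le hzC' ?_
      have := Complex.abs_re_le_norm ((z₀ : ℂ) + (t : ℂ) * Complex.I - C)
      refine le_trans ?_ this
      simp only [Complex.sub_re, Complex.add_re, Complex.ofReal_re, Complex.mul_re,
        Complex.I_re, mul_zero, Complex.ofReal_im, Complex.I_im, mul_one, sub_self, add_zero]
      rw [abs_sub_comm]
      exact le_abs_self _
    · have hi := intervalIntegrable_one_div_mul (intervalIntegrable_of_mem_Icc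
        (measurable_half_one_add_deriv ω) h.half_one_add_deriv_mem (-C) C) (him ht).ne'
      have hre := Complex.reCLM.intervalIntegral_comp_comm hi
      simp only [Complex.reCLM_apply, Complex.re_mul_ofReal] at hre
      rw [Complex.neg_re, ← hre, ← intervalIntegral.integral_neg]
      have hi' : IntervalIntegrable (fun w : ℝ =>
          -((1 / ((z₀ : ℂ) + (t : ℂ) * Complex.I - (w : ℂ))).re * ψ w)) volume (-C) C :=
        ((intervalIntegrable_of_mem_Icc (measurable_half_one_add_deriv ω)
          h.half_one_add_deriv_mem (-C) C).continuousOn_mul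
            (Complex.continuous_re.comp
              (continuous_one_div_sub_ofReal (him ht).ne')).continuousOn).neg
      refine (intervalIntegral.integral_mono_ae (by linarith) hi'
        (intervalIntegrable_const (c := 1 / δ)) ?_).trans (le_of_eq ?_)
      · have hne : ∀ᵐ w : ℝ, w ≠ z₀ := by simp [ae_iff]
        filter_upwards [hne] with w hw
        have hψm : ψ w ∈ Set.Icc (0 : ℝ) 1 := h.half_one_add_deriv_mem w
        have hre' : (1 / ((z₀ : ℂ) + (t : ℂ) * Complex.I - (w : ℂ))).re =
            (z₀ - w) / ((z₀ - w) ^ 2 + t ^ 2) := by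
          rw [one_div, Complex.inv_re]
          simp [Complex.normSq_apply]
          ring
        rw [hre']
        have hpos : 0 < (z₀ - w) ^ 2 + t ^ 2 := by positivity
        rcases lt_or_ge w z₀ with h1 | h1
        · have : 0 ≤ (z₀ - w) / ((z₀ - w) ^ 2 + t ^ 2) * ψ w :=
            mul_nonneg (div_nonneg (by linarith) hpos.le) hψm.1
          have : 0 < 1 / δ := by positivity
          linarith
        rcases lt_or_ge w (z₀ + δ) with h2 | h2
        · rw [hψ0 w (lt_of_le_of_ne h1 hw.symm) h2]
          simp only [mul_zero, neg_zero]
          positivity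
        · have h3 : (w - z₀) / ((z₀ - w) ^ 2 + t ^ 2) ≤ 1 / δ := by
            rw [div_le_div_iff₀ hpos hδ]
            nlinarith [sq_nonneg t]
          have h4 : 0 ≤ (w - z₀) / ((z₀ - w) ^ 2 + t ^ 2) :=
            div_nonneg (by linarith) hpos.le
          calc -((z₀ - w) / ((z₀ - w) ^ 2 + t ^ 2) * ψ w)
              = (w - z₀) / ((z₀ - w) ^ 2 + t ^ 2) * ψ w := by ring
            _ ≤ (w - z₀) / ((z₀ - w) ^ 2 + t ^ 2) := mul_le_of_le_one_right h4 hψm.2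
            _ ≤ 1 / δ := h3
      · rw [intervalIntegral.integral_const, smul_eq_mul]
        ring
  -- An atom at `z₀` would make `|G(z₀ + it)|` at least its mass divided by `t`, against the bound
  -- `B`.
  have hatom : ∀ t : ℝ, 0 < t → (transitionMeasure ω).real {z₀} ≤ t * B := by
    intro t ht
    have hint := integrable_one_div_sub_ofReal (transitionMeasure ω) (him ht)
    have h1 : (cauchyTransform ω ((z₀ : ℂ) + (t : ℂ) * Complex.I)).im =
        ∫ y, -(t / ((z₀ - y) ^ 2 + t ^ 2)) ∂transitionMeasure ω := by
      rw [hG _ (him ht)]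
      simp_rw [← im_one_div_sub_ofReal]
      exact (integral_im hint).symm
    have h2 : (transitionMeasure ω).real {z₀} ≤
        ∫ y, t * (t / ((z₀ - y) ^ 2 + t ^ 2)) ∂transitionMeasure ω := by
      rw [← integral_indicator_one (measurableSet_singleton z₀)]
      refine integral_mono ((integrable_const (1 : ℝ)).indicator (measurableSet_singleton z₀))
        ?_ fun y => ?_
      · have := (hint.im.neg).const_mul t
        refine this.congr (Eventually.of_forall fun y => ?_)
        have := im_one_div_sub_ofReal z₀ y t
        simp only [Pi.neg_apply, RCLike.im_to_complex]
        rw [this, neg_neg]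
      · by_cases hy : y = z₀
        · subst hy
          simp only [Set.mem_singleton_iff, Set.indicator_of_mem, Pi.one_apply, sub_self]
          refine le_of_eq ?_
          field_simp
          ring
        · rw [Set.indicator_of_notMem (by simpa using hy)]
          positivity
    rw [integral_const_mul] at h2
    rw [integral_neg] at h1
    refine h2.trans (mul_le_mul_of_nonneg_left ?_ ht.le)
    rw [← neg_eq_iff_eq_neg.2 h1]
    exact (neg_le_abs _).trans ((Complex.abs_im_le_norm _).trans (hbound t ht))
  have hlim : Tendsto (fun t : ℝ => t * B) (𝓝[>] 0) (𝓝 (0 * B)) :=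
    (tendsto_id.mul_const B).mono_left nhdsWithin_le_nhds
  rw [zero_mul] at hlim
  have h0 : (transitionMeasure ω).real {z₀} ≤ 0 :=
    ge_of_tendsto hlim (by filter_upwards [self_mem_nhdsWithin] with t ht using hatom t ht)
  exact (measureReal_eq_zero_iff).1 (le_antisymm h0 measureReal_nonneg)

/-- To the right of a point the function is affine of slope `1` or affine of slope `-1`. -/
def HasRightSlopeOne (f : ℝ → ℝ) (z₀ : ℝ) : Prop :=
  (∀ᶠ u in 𝓝[≥] z₀, f u = f z₀ + (u - z₀)) ∨ ∀ᶠ u in 𝓝[≥] z₀, f u = f z₀ - (u - z₀)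

theorem hasRightSlopeOne_abs_sub (b z₀ : ℝ) : HasRightSlopeOne (fun u => |u - b|) z₀ := by
  rcases le_or_gt b z₀ with h | h
  · left
    filter_upwards [self_mem_nhdsWithin] with u hu
    have hu' : z₀ ≤ u := hu
    rw [abs_of_nonneg (by linarith), abs_of_nonneg (by linarith)]
    ring
  · right
    filter_upwards [nhdsWithin_le_nhds (gt_mem_nhds h)] with u hu
    rw [abs_of_neg (by linarith), abs_of_neg (by linarith)]
    ring

theorem HasRightSlopeOne.const_sub {f : ℝ → ℝ} {z₀ : ℝ} (hf : HasRightSlopeOne f z₀) (c : ℝ) :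
    HasRightSlopeOne (fun u => c - f u) z₀ := by
  rcases hf with h | h
  · right
    filter_upwards [h] with u hu
    rw [hu]
    ring
  · left
    filter_upwards [h] with u hu
    rw [hu]
    ring

theorem HasRightSlopeOne.continuousWithinAt {f : ℝ → ℝ} {z₀ : ℝ} (hf : HasRightSlopeOne f z₀) :
    ContinuousWithinAt f (Set.Ici z₀) z₀ := by
  rcases hf with h | h
  · exact ((by fun_prop : Continuous fun u => f z₀ + (u - z₀)).continuousWithinAt).congr_of_eventuallyEq
      h (by simp)
  · exact ((by fun_prop : Continuous fun u => f z₀ - (u - z₀)).continuousWithinAt).congr_of_eventuallyEq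
      h (by simp)

theorem HasRightSlopeOne.congr {f g : ℝ → ℝ} {z₀ : ℝ} (hf : HasRightSlopeOne f z₀)
    (h : ∀ᶠ u in 𝓝[≥] z₀, g u = f u) : HasRightSlopeOne g z₀ := by
  have h0 : g z₀ = f z₀ := h.self_of_nhdsWithin Set.self_mem_Ici
  refine hf.imp (fun h' => ?_) fun h' => ?_
  all_goals
    filter_upwards [h, h'] with u hu hu'
    rw [hu, hu', h0]

/-- If the values at `z₀` differ, continuity keeps the larger function on top. If they agree, the
maximum of two lines of slope `±1` from a common point is, to the right, the steeper of the two. -/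
theorem HasRightSlopeOne.max {f g : ℝ → ℝ} {z₀ : ℝ} (hf : HasRightSlopeOne f z₀)
    (hg : HasRightSlopeOne g z₀) : HasRightSlopeOne (fun u => max (f u) (g u)) z₀ := by
  rcases lt_trichotomy (f z₀) (g z₀) with h | h | h
  · refine hg.congr ?_
    filter_upwards [hf.continuousWithinAt.eventually_lt hg.continuousWithinAt h] with u hu
    exact max_eq_right hu.le
  · rcases hf with hf | hf
    · left
      rcases hg with hg | hg <;>
      · filter_upwards [hf, hg, self_mem_nhdsWithin] with u hu hu' hz
        have hz' : z₀ ≤ u := hz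
        rw [hu, hu', h, max_self, max_eq_left (by linarith)]
    · rcases hg with hg | hg
      · left
        filter_upwards [hf, hg, self_mem_nhdsWithin] with u hu hu' hz
        have hz' : z₀ ≤ u := hz
        rw [hu, hu', h, max_self, max_eq_right (by linarith)]
      · right
        filter_upwards [hf, hg] with u hu hu'
        rw [hu, hu', h, max_self, max_self]
  · refine hf.congr ?_
    filter_upwards [hg.continuousWithinAt.eventually_lt hf.continuousWithinAt h] with u hu
    exact max_eq_left hu.le

theorem hasRightSlopeOne_profile (lam : YoungDiagram) (z₀ : ℝ) :
    HasRightSlopeOne (profile lam) z₀ := by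
  unfold profile
  induction lam.cells using Finset.induction_on with
  | empty => simpa using hasRightSlopeOne_abs_sub 0 z₀
  | insert c s hc ih =>
    simp only [Finset.fold_insert hc]
    exact ((hasRightSlopeOne_abs_sub _ z₀).const_sub _).max ih

theorem exists_forall_lt_of_eventually_nhdsGE {p : ℝ → Prop} {z₀ : ℝ}
    (h : ∀ᶠ u in 𝓝[≥] z₀, p u) : ∃ δ > 0, ∀ u, z₀ ≤ u → u < z₀ + δ → p u := by
  obtain ⟨b, hb, hb'⟩ := mem_nhdsGE_iff_exists_Ico_subset.1 h
  refine ⟨b - z₀, sub_pos.2 hb, fun u h1 h2 => hb' ⟨h1, by linarith⟩⟩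

theorem cumulativeFunction_profile_le {lam₁ lam₂ : YoungDiagram} {z₀ : ℝ}
    (hl : ∀ z, z ≤ z₀ → profile lam₂ z ≤ profile lam₁ z)
    (hr : ∀ z, z₀ ≤ z → profile lam₁ z ≤ profile lam₂ z) :
    cumulativeFunction (profile lam₁) z₀ ≤ cumulativeFunction (profile lam₂) z₀ := by
  have h₁ := isContinualDiagram_profile lam₁
  have h₂ := isContinualDiagram_profile lam₂
  have h : profile lam₁ z₀ = profile lam₂ z₀ := le_antisymm (hr z₀ le_rfl) (hl z₀ le_rfl)
  rcases hasRightSlopeOne_profile lam₁ z₀ with hs | hs <;>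
    obtain ⟨δ, hδ, hs⟩ := exists_forall_lt_of_eventually_nhdsGE hs
  -- Slope `1` is the largest a diagram may have, so `ω₂` cannot exceed `ω₁` on `(z₀, z₀ + δ)`. The
  -- two agree there, and the comparison includes the point `z₀`.
  · refine (cumulativeFunction_le_piecewise h₁ h₂ h hr (fun z hz hz' => ?_)
      (lt_add_of_pos_right z₀ hδ)).trans (cumulativeFunction_piecewise_le h₁ h₂ hl hr)
    refine le_antisymm (hr z hz.le) ?_
    have := (abs_le.1 (h₂.lipschitz z z₀)).2
    rw [abs_of_pos (sub_pos.2 hz)] at this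
    rw [hs z hz.le hz']
    linarith
  -- With slope `-1` there is no atom at `z₀`, so the comparison on the open half-line `(-∞, z₀)`
  -- loses nothing.
  · have := h₁.isProbabilityMeasure_transitionMeasure
    have hatom := h₁.transitionMeasure_singleton_eq_zero hδ hs
    have hp := h₁.piecewise h₂ h
    have := hp.isProbabilityMeasure_transitionMeasure
    have hIic : transitionMeasure (profile lam₁) (Set.Iic z₀) ≤
        transitionMeasure (profile lam₁) (Set.Iio z₀) := by
      rw [← Set.Iio_union_right]
      exact (measure_union_le _ _).trans (by rw [hatom, add_zero])
    have hle : transitionMeasure (profile lam₁) (Set.Iio z₀) ≤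
        transitionMeasure (fun z => if z ≤ z₀ then profile lam₁ z else profile lam₂ z)
          (Set.Iio z₀) := by
      refine transitionMeasure_le h₁ hp (fun z => ?_) isOpen_Iio (fun z hz => ?_)
        measurableSet_Iio le_rfl
      · split_ifs with h'
        exacts [le_rfl, hr z (not_le.1 h').le]
      · rw [if_pos (le_of_lt hz)]
    refine le_trans ?_ (cumulativeFunction_piecewise_le h₁ h₂ hl hr)
    exact (ENNReal.toReal_le_toReal (measure_ne_top _ _) (measure_ne_top _ _)).2
      (hIic.trans (hle.trans (measure_mono Set.Iio_subset_Iic_self)))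

end ContinualDiagrams

theorem mainTheorem5 :
    (∀ (ω₁ ω₂ : ℝ → ℝ) (z₀ : ℝ),
      ContinualDiagrams.IsContinualDiagram ω₁ → ContinualDiagrams.IsContinualDiagram ω₂ →
      (∀ z, z ≤ z₀ → ω₂ z ≤ ω₁ z) → (∀ z, z₀ ≤ z → ω₁ z ≤ ω₂ z) →
      ∃ l : ℝ,
        Tendsto (fun τ : ℝ => ContinualDiagrams.cumulativeFunction ω₁ (z₀ - τ)) (𝓝[>] 0) (𝓝 l) ∧
        l ≤ ContinualDiagrams.cumulativeFunction ω₂ z₀) ∧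
    (∀ (lam₁ lam₂ : YoungDiagram) (z₀ : ℝ),
      (∀ z, z ≤ z₀ → ContinualDiagrams.profile lam₂ z ≤ ContinualDiagrams.profile lam₁ z) →
      (∀ z, z₀ ≤ z → ContinualDiagrams.profile lam₁ z ≤ ContinualDiagrams.profile lam₂ z) →
      ContinualDiagrams.cumulativeFunction (ContinualDiagrams.profile lam₁) z₀ ≤
        ContinualDiagrams.cumulativeFunction (ContinualDiagrams.profile lam₂) z₀) := by
  refine ⟨fun ω₁ ω₂ z₀ h₁ h₂ hl hr => ?_, fun lam₁ lam₂ z₀ hl hr =>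
    ContinualDiagrams.cumulativeFunction_profile_le hl hr⟩
  have hτ : Tendsto (fun τ : ℝ => z₀ - τ) (𝓝[>] 0) (𝓝[<] z₀) := by
    refine tendsto_nhdsWithin_iff.2 ⟨?_, ?_⟩
    · have : Tendsto (fun τ : ℝ => z₀ - τ) (𝓝 0) (𝓝 (z₀ - 0)) :=
        (by fun_prop : Continuous fun τ : ℝ => z₀ - τ).tendsto 0
      rw [sub_zero] at this
      exact this.mono_left nhdsWithin_le_nhds
    · filter_upwards [self_mem_nhdsWithin] with τ hτ
      exact sub_lt_self z₀ hτ
  have hlim := (h₁.monotone_cumulativeFunction.tendsto_nhdsLT z₀).comp hτ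
  refine ⟨_, hlim, le_of_tendsto hlim ?_⟩
  filter_upwards [self_mem_nhdsWithin] with τ hτ
  exact ContinualDiagrams.cumulativeFunction_le_of_lt h₁ h₂ hl hr (sub_lt_self z₀ hτ)
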